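/- Let $D$ be a link diagram with finite set of crossings $A$. Let $\mathbf{B}$ be the poset of subsets of $A$ ordered by reverse inclusion ($x\le y$ iff $x\supseteq y$), with maximal element $\mathbf{1}=\varnothing$, and write $x\prec y$ if $x=y\cup\{c\}$ with $c\notin y$. For $x\subseteq A$ let $D(x)$ be the collection of planar circles obtained by $1$-resolving the crossings in $x$ and $0$-resolving the others. Here, if the four ends at a crossing are numbered $0,1,2,3$ counterclockwise with $0$ and $2$ the ends of the under-strand, the $0$-resolution joins $0$ to $1$ and $2$ to $3$, and the $1$-resolution joins $0$ to $3$ and $1$ to $2$. Let $V=\mathbb{Z}[1,u]$ be free abelian on $1,u$, with the commutative multiplication $m$ having unit $1$ and $u\cdot u=0$, and the comultiplication $\Delta(1)=1\otimes u+u\otimes 1$, $\Delta(u)=u\otimes u$. The Khovanov presheaf $F_{KH}\colon\mathbf{B}^{\mathrm{op}}\to\mathbf{Ab}$ is the functor that sends $x$ to the tensor product of copies of $V$, one for each circle of $D(x)$, and that sends $x\prec y$ to the homomorphism $F_{KH}(y)\to F_{KH}(x)$ given by $m$ on the factors of two circles of $D(y)$ that fuse into one of $D(x)$, or by $\Delta$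 on the factor of a circle of $D(y)$ that bifurcates into two of $D(x)$, and by the identity on the factors of all other circles. Choose signs $[x,y]=\pm1$ for all $x\prec y$ in $\mathbf{B}$ such that every square face of the cube has an odd number of minus signs on its edges. The Khovanov complex is $K^n=\bigoplus_{|x|=n}F_{KH}(x)$, with differential $d=\sum_{x\prec y,\,|x|=n}[x,y]\,F_{KH}(x\prec y)\colon K^{n-1}\to K^n$, and the unnormalised Khovanov homology is $\overline{KH}^i(D)=H^i(K^*,d)$. Let $\mathbf{B}'$ be the poset obtained from $\mathbf{B}$ by adjoining one element $\mathbf{1}'$ with $x\le\mathbf{1}'$ exactly for $x=\mathbf{1}'$ and for $x\in\mathbf{B}$, $x\ne\mathbf{1}$, and with $\mathbf{1}'\le x$ only for $x=\mathbf{1}'$. Extend $F_{KH}$ to a functor $F_{KH}\colon\mathbf{B}'^{\mathrm{op}}\to\mathbf{Ab}$ by $F_{KH}(\mathbf{1}')=0$. Let $\varprojlim^i_{\mathbf{B}'^{\mathrm{op}}}$ be the $i$-th right derived functor of the inverse limit functor from the category of functors $\mathbf{B}'^{\mathrm{op}}\to\mathbf{Ab}$ to $\mathbf{Ab}$. Then,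 for every such choice of signs and every $i\ge 0$, $$\overline{KH}^i(D)\;\cong\;\varprojlim_{\mathbf{B}'^{\mathrm{op}}}{}^{\!i}\,F_{KH}$$ as abelian groups. -/

import Mathlib

open CategoryTheory Limits
open scoped TensorProduct

/-! ### Link diagrams -/

/-- The combinatorial data of a link diagram on an oriented surface.
Around every crossing `c` there are four half-edges ("darts") `(c, 0), (c, 1), (c, 2), (c, 3)`,
listed counterclockwise, where `(c, 0)` and `(c, 2)` are the two ends of the under-strand and
`(c, 1)` and `(c, 3)` are the two ends of the over-strand. The fixed-point-free involution `opp`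
sends a dart to the other end of the edge of the diagram that it begins. Components of the diagram
without any crossing are recorded by their number. -/
structure DiagramCode where
  Crossing : Type
  [fintypeCrossing : Fintype Crossing]
  [decidableEqCrossing : DecidableEq Crossing]
  opp : Crossing × ZMod 4 → Crossing × ZMod 4
  opp_opp : ∀ h, opp (opp h) = h
  opp_ne : ∀ h, opp h ≠ h
  freeCircles : ℕ

attribute [instance] DiagramCode.fintypeCrossing DiagramCode.decidableEqCrossing

namespace DiagramCode

variable (D : DiagramCode)

abbrev Dart : Type := D.Crossing × ZMod 4

/-- The next dart counterclockwise around the same crossing. -/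
def rot (h : D.Dart) : D.Dart := (h.1, h.2 + 1)

/-- The edges of the underlying 4-valent graph. -/
def Edge : Type := Quot fun h h' : D.Dart => h' = D.opp h

/-- The faces of the underlying 4-valent graph, drawn on the closed oriented surface that the
cyclic orders at the crossings determine: walk along an edge, then turn at the crossing. -/
def Face : Type := Quot fun h h' : D.Dart => h' = D.rot (D.opp h)

/-- The connected components of the underlying 4-valent graph. -/
def Component : Type := Quot fun h h' : D.Dart => h' = D.rot h ∨ h' = D.opp h

end DiagramCode

/-- A link diagram: the code has to be planar, that is, the closed surface determined by each
connected component of the 4-valent graph is a sphere. A connected closed oriented surface has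
Euler characteristic at most two, with equality only for the sphere, so this says that `V - E + F`
is twice the number of components. -/
structure LinkDiagram extends DiagramCode where
  planar : (Nat.card Crossing : ℤ) - Nat.card toDiagramCode.Edge + Nat.card toDiagramCode.Face
    = 2 * Nat.card toDiagramCode.Component

namespace LinkDiagram

variable (D : LinkDiagram)

/-- The pieces from which the complete resolutions are assembled: half-edges and free circles. -/
abbrev Arc : Type := D.Dart ⊕ Fin D.freeCircles

/-- The complete resolution at the set `x` of crossings joins `(c, 0)` to `(c, 1)` and `(c, 2)` to
`(c, 3)` at a crossing `c ∉ x` (the `0`-resolution), and it joins `(c, 0)` to `(c, 3)` and `(c, 1)`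
to `(c, 2)` at a crossing `c ∈ x` (the `1`-resolution). -/
def smooth (x : Finset D.Crossing) (h : D.Dart) : D.Dart :=
  (h.1, if h.1 ∈ x then 3 - h.2 else 1 - h.2)

/-- Two arcs that touch each other in the complete resolution `D(x)`. -/
inductive Joined (x : Finset D.Crossing) : D.Arc → D.Arc → Prop
  | edge (h : D.Dart) : Joined x (Sum.inl h) (Sum.inl (D.opp h))
  | crossing (h : D.Dart) : Joined x (Sum.inl h) (Sum.inl (D.smooth x h))

/-- Lying on the same circle of `D(x)`. -/
def sameCircle (x : Finset D.Crossing) : Setoid D.Arc := Relation.EqvGen.setoid (D.Joined x)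

/-- The circles, i.e. the connected components, of the complete resolution `D(x)`. -/
def Circle (x : Finset D.Crossing) : Type := Quotient (D.sameCircle x)

/-- The circle of `D(x)` that contains the arc `e`. -/
def circle (x : Finset D.Crossing) (e : D.Arc) : D.Circle x := Quotient.mk (D.sameCircle x) e

end LinkDiagram

/-! ### The planar diagram has a source-sink orientation -/

namespace DiagramCode

variable (D : DiagramCode)

lemma opp_invol : Function.Involutive D.opp := D.opp_opp

instance : Finite D.Edge := Finite.of_surjective (Quot.mk _) Quot.mk_surjective
instance : Finite D.Face := Finite.of_surjective (Quot.mk _) Quot.mk_surjective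
instance : Finite D.Component := Finite.of_surjective (Quot.mk _) Quot.mk_surjective
noncomputable instance : Fintype D.Edge := Fintype.ofFinite _
noncomputable instance : Fintype D.Face := Fintype.ofFinite _
noncomputable instance : Fintype D.Component := Fintype.ofFinite _
noncomputable instance : DecidableEq D.Edge := Classical.decEq _

def toEdge (h : D.Dart) : D.Edge := Quot.mk _ h
def toFace (h : D.Dart) : D.Face := Quot.mk _ h
def toComp (h : D.Dart) : D.Component := Quot.mk _ h

lemma toEdge_opp (h : D.Dart) : D.toEdge (D.opp h) = D.toEdge h :=
  (Quot.sound (r := fun h h' : D.Dart => h' = D.opp h) rfl).symm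
lemma toFace_opp (h : D.Dart) : D.toFace (D.opp h) = D.toFace (D.rot h) :=
  Quot.sound (by rw [D.opp_opp])

lemma toEdge_eq {h h' : D.Dart} : D.toEdge h = D.toEdge h' ↔ h' = h ∨ h' = D.opp h := by
  constructor
  · intro e
    have := Quot.eqvGen_exact e
    induction this with
    | rel _ _ r => exact Or.inr r
    | refl _ => exact Or.inl rfl
    | symm a b _ ih =>
      rcases ih (by rename_i q; exact Quot.eqvGen_sound q) with rfl | rfl
      · exact Or.inl rfl
      · exact Or.inr (D.opp_opp _).symm
    | trans a b c q1 q2 ih1 ih2 =>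
      rcases ih1 (Quot.eqvGen_sound q1) with rfl | rfl <;>
      rcases ih2 (Quot.eqvGen_sound q2) with rfl | rfl <;> simp [D.opp_opp]
  · rintro (rfl | rfl)
    · rfl
    · exact (D.toEdge_opp h).symm

/-- A function constant along rotation and edges comes from the components. -/
lemma exists_comp_fun (g : D.Dart → ZMod 2) (h1 : ∀ h, g (D.rot h) = g h)
    (h2 : ∀ h, g (D.opp h) = g h) : ∃ f : D.Component → ZMod 2, ∀ h, f (D.toComp h) = g h :=
  ⟨Quot.lift g (by rintro a b (rfl | rfl) <;> simp [h1, h2]), fun _ => rfl⟩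

/-- The crossing-edge incidence matrix modulo two. -/
noncomputable def incidence : Matrix D.Crossing D.Edge (ZMod 2) :=
  fun c e => ∑ i : ZMod 4, if D.toEdge (c, i) = e then 1 else 0

lemma incidence_mulVec (w : D.Edge → ZMod 2) (c : D.Crossing) :
    (D.incidence.mulVec w) c = ∑ i : ZMod 4, w (D.toEdge (c, i)) := by
  simp only [Matrix.mulVec, dotProduct, incidence, Finset.sum_mul]
  rw [Finset.sum_comm]
  simp

lemma incidence_vecMul (g : D.Crossing → ZMod 2) (h : D.Dart) :
    (D.incidence.transpose.mulVec g) (D.toEdge h) = g h.1 + g (D.opp h).1 := by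
  classical
  simp only [Matrix.mulVec, dotProduct, incidence, Matrix.transpose_apply, Finset.sum_mul]
  rw [← Finset.sum_product' (s := Finset.univ) (t := Finset.univ)
    (f := fun (c : D.Crossing) (i : ZMod 4) =>
      (if D.toEdge (c, i) = D.toEdge h then (1 : ZMod 2) else 0) * g c)]
  have : ∀ k : D.Dart, (if D.toEdge (k.1, k.2) = D.toEdge h then (1 : ZMod 2) else 0) * g k.1
      = if k ∈ ({h, D.opp h} : Finset D.Dart) then g k.1 else 0 := by
    intro k
    have : D.toEdge (k.1, k.2) = D.toEdge h ↔ k ∈ ({h, D.opp h} : Finset D.Dart) := by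
      rw [eq_comm, D.toEdge_eq]; simp
    simp [this]
  simp only [Finset.univ_product_univ]
  rw [Finset.sum_congr rfl (fun k _ => this k)]
  rw [Finset.sum_ite_mem, Finset.univ_inter, Finset.sum_pair (D.opp_ne h).symm]

/-- The face-edge boundary map modulo two. -/
noncomputable def faceBoundary : (D.Face → ZMod 2) →ₗ[ZMod 2] (D.Edge → ZMod 2) where
  toFun f := Quot.lift (fun h => f (D.toFace h) + f (D.toFace (D.opp h)))
    (by rintro a b rfl; rw [D.opp_opp, add_comm])
  map_add' f g := by
    funext e; obtain ⟨h, rfl⟩ := Quot.mk_surjective e; exact add_add_add_comm _ _ _ _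
  map_smul' r f := by
    funext e; obtain ⟨h, rfl⟩ := Quot.mk_surjective e
    exact (mul_add _ _ _).symm

lemma faceBoundary_apply (f : D.Face → ZMod 2) (h : D.Dart) :
    D.faceBoundary f (D.toEdge h) = f (D.toFace h) + f (D.toFace (D.opp h)) := rfl

lemma finrank_le_of_comp {W : Submodule (ZMod 2) (D.Dart → ZMod 2)}
    (hW : ∀ g ∈ W, (∀ h, g (D.rot h) = g h) ∧ ∀ h, g (D.opp h) = g h) :
    Module.finrank (ZMod 2) W ≤ Nat.card D.Component := by
  let φ : (D.Component → ZMod 2) →ₗ[ZMod 2] (D.Dart → ZMod 2) := LinearMap.funLeft _ _ D.toComp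
  have : W ≤ LinearMap.range φ := by
    intro g hg
    obtain ⟨f, hf⟩ := D.exists_comp_fun g (hW g hg).1 (hW g hg).2
    exact ⟨f, funext hf⟩
  calc _ ≤ _ := Submodule.finrank_mono this
    _ ≤ _ := LinearMap.finrank_range_le φ
    _ = _ := by simp

end DiagramCode

namespace LinkDiagram

variable (D : LinkDiagram)

lemma zmod4_cases : ∀ i : ZMod 4, i = 0 ∨ i = 1 ∨ i = 2 ∨ i = 3 := by decide

lemma zmod2_eq {a b : ZMod 2} : a + b = 0 ↔ b = a := by revert a b; decide

lemma exists_sourceSink : ∃ s : D.Dart → ZMod 2,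
    (∀ h, s (D.opp h) = s h + 1) ∧ ∀ h, s (D.rot h) = s h + 1 := by
  classical
  set M := D.incidence with hM
  have range_le : LinearMap.range D.faceBoundary ≤ LinearMap.ker M.mulVecLin := by
    rintro _ ⟨f, rfl⟩
    rw [LinearMap.mem_ker]
    funext c
    rw [Matrix.mulVecLin_apply, D.incidence_mulVec]
    simp only [D.faceBoundary_apply, D.toFace_opp, DiagramCode.rot, Pi.zero_apply]
    change ∑ i : Fin 4, _ = _
    rw [Fin.sum_univ_four]
    have e1 : ((1 : ZMod 4) + 1) = 2 := by decide
    have e2 : ((2 : ZMod 4) + 1) = 3 := by decide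
    have e3 : ((3 : ZMod 4) + 1) = 0 := by decide
    have : ∀ a b c d : ZMod 2, a + b + (b + c) + (c + d) + (d + a) = 0 := by decide
    refine Eq.trans ?_ (this (f (D.toFace (c, 0))) (f (D.toFace (c, 1))) (f (D.toFace (c, 2)))
      (f (D.toFace (c, 3))))
    congr 1
  have kerF : Module.finrank (ZMod 2) (LinearMap.ker D.faceBoundary) ≤ Nat.card D.Component := by
    let φ : (D.Face → ZMod 2) →ₗ[ZMod 2] (D.Dart → ZMod 2) := LinearMap.funLeft _ _ D.toFace
    have hφ : Function.Injective φ :=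
      LinearMap.funLeft_injective_of_surjective _ _ _ Quot.mk_surjective
    rw [(Submodule.equivMapOfInjective φ hφ (LinearMap.ker D.faceBoundary)).finrank_eq]
    apply D.finrank_le_of_comp
    rintro _ ⟨f, hf, rfl⟩
    have key : ∀ h, f (D.toFace (D.opp h)) = f (D.toFace h) := fun h => by
      have := congrFun (LinearMap.mem_ker.1 hf) (D.toEdge h)
      rw [D.faceBoundary_apply] at this
      exact zmod2_eq.1 this
    refine ⟨fun h => ?_, key⟩
    change f (D.toFace _) = f (D.toFace _)
    rw [← D.toFace_opp, key]
  have kerV : Module.finrank (ZMod 2) (LinearMap.ker M.transpose.mulVecLin)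
      ≤ Nat.card D.Component := by
    let φ : (D.Crossing → ZMod 2) →ₗ[ZMod 2] (D.Dart → ZMod 2) := LinearMap.funLeft _ _ Prod.fst
    have hφ : Function.Injective φ :=
      LinearMap.funLeft_injective_of_surjective _ _ _ Prod.fst_surjective
    rw [(Submodule.equivMapOfInjective φ hφ (LinearMap.ker M.transpose.mulVecLin)).finrank_eq]
    apply D.finrank_le_of_comp
    rintro _ ⟨g, hg, rfl⟩
    refine ⟨fun h => rfl, fun h => ?_⟩
    have := congrFun (LinearMap.mem_ker.1 hg) (D.toEdge h)
    rw [Matrix.mulVecLin_apply, D.incidence_vecMul] at this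
    exact zmod2_eq.1 this
  have r1 := D.faceBoundary.finrank_range_add_finrank_ker
  have r2 := M.mulVecLin.finrank_range_add_finrank_ker
  have r3 := M.transpose.mulVecLin.finrank_range_add_finrank_ker
  have r4 : Module.finrank (ZMod 2) (LinearMap.range M.transpose.mulVecLin)
      = Module.finrank (ZMod 2) (LinearMap.range M.mulVecLin) := M.rank_transpose
  have hp := D.planar
  simp only [Module.finrank_fintype_fun_eq_card, ← Nat.card_eq_fintype_card] at r1 r2 r3
  have heq : LinearMap.range D.faceBoundary = LinearMap.ker M.mulVecLin := by
    apply Submodule.eq_of_le_of_finrank_le range_le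
    omega
  have h1 : (fun _ => 1 : D.Edge → ZMod 2) ∈ LinearMap.ker M.mulVecLin := by
    rw [LinearMap.mem_ker]
    funext c
    rw [Matrix.mulVecLin_apply, D.incidence_mulVec]
    change ∑ i : Fin 4, (1 : ZMod 2) = 0
    decide
  rw [← heq] at h1
  obtain ⟨f, hf⟩ := h1
  have key : ∀ h, f (D.toFace (D.opp h)) = f (D.toFace h) + 1 := fun h => by
    have := congrFun hf (D.toEdge h)
    rw [D.faceBoundary_apply] at this
    revert this
    generalize f (D.toFace h) = a
    generalize f (D.toFace (D.opp h)) = b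
    revert a b
    decide
  exact ⟨fun h => f (D.toFace h), key, fun h => by
    change f (D.toFace (D.rot h)) = _
    rw [← D.toFace_opp, key]⟩

end LinkDiagram

/-! ### Changing the resolution of one crossing merges two circles or splits one -/

section Cycles

variable {α : Type*}

lemma not_sameCycle_of_pow {t : Equiv.Perm α} [Finite α] {a b : α} {n : ℕ} (hn : 0 < n)
    (ha : (t ^ n) a = a) (hb : ∀ k < n, (t ^ k) a ≠ b) : ¬ t.SameCycle a b := by
  intro h
  obtain ⟨m, hm⟩ := h.exists_nat_pow_eq
  apply hb (m % n) (Nat.mod_lt _ hn)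
  rw [← hm]
  conv_rhs => rw [← Nat.mod_add_div m n, pow_add, Equiv.Perm.mul_apply, pow_mul]
  congr 1
  exact (Equiv.Perm.pow_apply_eq_self_of_apply_eq_self ha _).symm

lemma sameCycle_iff_not_of_swap [Finite α] [DecidableEq α] {t t' : Equiv.Perm α} {a b : α}
    (hab : a ≠ b) (S : α → Prop) (hS : ∀ h, S h → S (t h)) (ha : S a)
    (ht : ∀ h, S h → t' h = Equiv.swap a b (t h)) : t.SameCycle a b ↔ ¬ t'.SameCycle a b := by
  classical
  have ex : ∃ n, 0 < n ∧ ((t ^ n) a = a ∨ (t ^ n) a = b) :=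
    ⟨orderOf t, orderOf_pos t, Or.inl (by simp [pow_orderOf_eq_one])⟩
  obtain ⟨n, ⟨hn, hnab⟩, hmin⟩ : ∃ n, (0 < n ∧ ((t ^ n) a = a ∨ (t ^ n) a = b)) ∧
      ∀ k < n, ¬ (0 < k ∧ ((t ^ k) a = a ∨ (t ^ k) a = b)) :=
    ⟨Nat.find ex, Nat.find_spec ex, fun k hk => Nat.find_min ex hk⟩
  have hSk : ∀ k, S ((t ^ k) a) := by
    intro k
    induction k with
    | zero => simpa using ha
    | succ k ih => rw [pow_succ', Equiv.Perm.mul_apply]; exact hS _ ih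
  have hk : ∀ k < n, (t' ^ k) a = (t ^ k) a := by
    intro k
    induction k with
    | zero => simp
    | succ k ih =>
      intro hkn
      rw [pow_succ', Equiv.Perm.mul_apply, ih (by omega), ht _ (hSk k), ← Equiv.Perm.mul_apply t,
        ← pow_succ']
      have := hmin _ hkn
      apply Equiv.swap_apply_of_ne_of_ne <;> intro h <;> exact this ⟨by omega, by tauto⟩
  have hlast : (t' ^ n) a = Equiv.swap a b ((t ^ n) a) := by
    obtain ⟨m, rfl⟩ : ∃ m, n = m + 1 := ⟨n - 1, by omega⟩
    rw [pow_succ', Equiv.Perm.mul_apply, hk m (by omega), ht _ (hSk m), ← Equiv.Perm.mul_apply t,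
      ← pow_succ']
  have hb : ∀ k < n, (t ^ k) a ≠ b := by
    intro k hkn h
    rcases Nat.eq_zero_or_pos k with rfl | h0
    · exact hab (by simpa using h)
    · exact hmin k hkn ⟨h0, Or.inr h⟩
  rcases hnab with h | h
  · have h1 := not_sameCycle_of_pow hn h hb
    have h2 : t'.SameCycle a b := ⟨n, by rw [zpow_natCast, hlast, h, Equiv.swap_apply_left]⟩
    tauto
  · have h1 : t.SameCycle a b := ⟨n, by rw [zpow_natCast, h]⟩
    have h2 := not_sameCycle_of_pow (t := t') (b := b) hn
      (by rw [hlast, h, Equiv.swap_apply_right]) (fun k hkn => by rw [hk k hkn]; exact hb k hkn)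
    tauto

/-- The equivalence relation obtained from `r` by identifying the classes of `p` and `q`. -/
def glue (r : Setoid α) (p q : α) : Setoid α where
  r e f := r e f ∨ ((r e p ∨ r e q) ∧ (r f p ∨ r f q))
  iseqv :=
    { refl := fun e => Or.inl (r.refl e)
      symm := by
        rintro e f (h | h)
        · exact Or.inl (r.symm h)
        · exact Or.inr h.symm
      trans := by
        rintro e f g (h | ⟨h1, h2⟩) (k | ⟨k1, k2⟩)
        · exact Or.inl (r.trans h k)
        · exact Or.inr ⟨k1.imp (r.trans h) (r.trans h), k2⟩
        · exact Or.inr ⟨h1, h2.imp (r.trans (r.symm k)) (r.trans (r.symm k))⟩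
        · exact Or.inr ⟨h1, k2⟩ }

lemma le_glue (r : Setoid α) (p q : α) : r ≤ glue r p q := fun _ _ h => Or.inl h

lemma glue_rel (r : Setoid α) (p q : α) : glue r p q p q :=
  Or.inr ⟨Or.inl (r.refl p), Or.inr (r.refl q)⟩

lemma glue_le {r s : Setoid α} {p q : α} (h : r ≤ s) (hpq : s p q) : glue r p q ≤ s := by
  rintro e f (k | ⟨k1, k2⟩)
  · exact h k
  · have : ∀ g, (r g p ∨ r g q) → s g p := fun g k =>
      k.elim (fun k => h k) (fun k => s.trans (h k) (s.symm hpq))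
    exact s.trans (this e k1) (s.symm (this f k2))

lemma glue_eq_self {r : Setoid α} {p q : α} (h : r p q) : glue r p q = r :=
  le_antisymm (glue_le le_rfl h) (le_glue r p q)

lemma card_glue [Finite α] {r : Setoid α} {p q : α} (h : ¬ r p q) :
    Nat.card (Quotient r) = Nat.card (Quotient (glue r p q)) + 1 := by
  classical
  have : Fintype (Quotient r) := Fintype.ofFinite _
  let π : {C : Quotient r // C ≠ Quotient.mk r q} → Quotient (glue r p q) :=
    fun C => Quotient.map' id (fun _ _ h => le_glue r p q h) C.1
  have hπ : Function.Bijective π := by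
    constructor
    · rintro ⟨C, hC⟩ ⟨C', hC'⟩ e
      obtain ⟨a, rfl⟩ := Quotient.mk_surjective C
      obtain ⟨b, rfl⟩ := Quotient.mk_surjective C'
      have e' : glue r p q a b := Quotient.exact e
      have hC : ¬ r a q := fun h => hC (Quotient.sound h)
      have hC' : ¬ r b q := fun h => hC' (Quotient.sound h)
      have : r a b := by
        rcases e' with h | ⟨h1, h2⟩
        · exact h
        · exact r.trans (h1.resolve_right hC) (r.symm (h2.resolve_right hC'))
      exact Subtype.ext (Quotient.sound this)
    · intro C
      obtain ⟨a, rfl⟩ := Quotient.mk_surjective C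
      by_cases ha : r a q
      · exact ⟨⟨Quotient.mk r p, fun e => h (Quotient.exact e)⟩,
          Quotient.sound ((glue r p q).trans (glue_rel r p q)
            ((glue r p q).symm (le_glue r p q ha)))⟩
      · exact ⟨⟨Quotient.mk r a, fun e => ha (Quotient.exact e)⟩, rfl⟩
  rw [← Nat.card_congr (Equiv.ofBijective π hπ), Nat.card_eq_fintype_card,
    Nat.card_eq_fintype_card, Fintype.card_subtype_compl, Fintype.card_subtype_eq]
  have : 0 < Fintype.card (Quotient r) := Fintype.card_pos_iff.2 ⟨Quotient.mk r q⟩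
  omega

/-- If gluing along `p', q'` makes `p` and `q` equivalent, the two pairs agree. -/
lemma pair_eq_of_glue {r : Setoid α} {p q p' q' : α} (h : ¬ r p q) (hg : glue r p' q' p q) :
    (r p p' ∧ r q q') ∨ (r p q' ∧ r q p') := by
  rcases hg with hg | ⟨h1 | h1, h2 | h2⟩
  · exact absurd hg h
  · exact absurd (r.trans h1 (r.symm h2)) h
  · exact Or.inl ⟨h1, h2⟩
  · exact Or.inr ⟨h1, h2⟩
  · exact absurd (r.trans h1 (r.symm h2)) h

end Cycles

namespace LinkDiagram

variable (D : LinkDiagram)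

lemma smooth_smooth (x : Finset D.Crossing) (h : D.Dart) : D.smooth x (D.smooth x h) = h := by
  unfold smooth
  ext
  · rfl
  · dsimp only
    split_ifs <;> ring

/-- The arc at the end `(c, 0)` of the under-strand. In each of the two resolutions of `c`, this arc
and the arc `armQ c` at the other end `(c, 2)` of the under-strand lie on the two different strands
that replace the crossing. -/
def armP (c : D.Crossing) : D.Arc := Sum.inl (c, 0)
/-- The arc at the end `(c, 2)` of the under-strand. -/
def armQ (c : D.Crossing) : D.Arc := Sum.inl (c, 2)

lemma sameCircle_le_iff {x : Finset D.Crossing} {s : Setoid D.Arc} :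
    D.sameCircle x ≤ s ↔ ∀ a b, D.Joined x a b → s a b := by
  constructor
  · intro h a b hab
    exact h (Relation.EqvGen.rel _ _ hab)
  · intro h a b hab
    induction hab with
    | rel _ _ r => exact h _ _ r
    | refl _ => exact s.refl _
    | symm _ _ _ ih => exact s.symm ih
    | trans _ _ _ _ _ ih1 ih2 => exact s.trans ih1 ih2

lemma same_opp (x : Finset D.Crossing) (h : D.Dart) :
    D.sameCircle x (Sum.inl h) (Sum.inl (D.opp h)) := Relation.EqvGen.rel _ _ (.edge h)

lemma same_smooth (x : Finset D.Crossing) (h : D.Dart) :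
    D.sameCircle x (Sum.inl h) (Sum.inl (D.smooth x h)) := Relation.EqvGen.rel _ _ (.crossing h)

lemma glue_le_glue {x y : Finset D.Crossing} {c : D.Crossing} (hxy : ∀ d, d ≠ c → (d ∈ x ↔ d ∈ y)) :
    glue (D.sameCircle x) (D.armP c) (D.armQ c) ≤ glue (D.sameCircle y) (D.armP c) (D.armQ c) := by
  apply glue_le _ (glue_rel _ _ _)
  rw [sameCircle_le_iff]
  rintro a b (h | ⟨d, i⟩)
  · exact le_glue _ _ _ (D.same_opp y h)
  · by_cases hd : d = c
    · subst hd
      have key : ∀ i : ZMod 4, D.sameCircle y (Sum.inl (d, i)) (D.armP d) ∨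
          D.sameCircle y (Sum.inl (d, i)) (D.armQ d) := by
        intro i
        have h := D.same_smooth y (d, i)
        have hi := zmod4_cases i
        rcases hi with rfl | rfl | rfl | rfl
        · exact Or.inl ((D.sameCircle y).refl _)
        · by_cases hdy : d ∈ y
          · right
            simp only [smooth, hdy, if_true] at h
            exact h
          · left
            simp only [smooth, hdy, if_false] at h
            exact h
        · exact Or.inr ((D.sameCircle y).refl _)
        · by_cases hdy : d ∈ y
          · left
            simp only [smooth, hdy, if_true] at h
            exact h
          · right
            simp only [smooth, hdy, if_false] at h
            exact h
      exact Or.inr ⟨key _, key _⟩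
    · have : D.smooth x (d, i) = D.smooth y (d, i) := by simp [smooth, hxy d hd]
      rw [this]
      exact le_glue _ _ _ (D.same_smooth y (d, i))

lemma glue_eq_glue {y : Finset D.Crossing} {c : D.Crossing} :
    glue (D.sameCircle y) (D.armP c) (D.armQ c)
      = glue (D.sameCircle (insert c y)) (D.armP c) (D.armQ c) :=
  le_antisymm (D.glue_le_glue (fun d hd => by simp [hd])) (D.glue_le_glue (fun d hd => by simp [hd]))

/-- Travelling along the circles of `D(x)`. -/
def travel (x : Finset D.Crossing) : Equiv.Perm D.Dart where
  toFun h := D.smooth x (D.opp h)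
  invFun h := D.opp (D.smooth x h)
  left_inv h := by simp [D.smooth_smooth, D.opp_opp]
  right_inv h := by simp [D.smooth_smooth, D.opp_opp]

lemma smooth_parity {s : D.Dart → ZMod 2} (hs : ∀ h, s (D.rot h) = s h + 1)
    (x : Finset D.Crossing) (h : D.Dart) : s (D.smooth x h) = s h + 1 := by
  obtain ⟨c, i⟩ := h
  have h0 := hs (c, 0)
  have h1 := hs (c, 1)
  have h2 := hs (c, 2)
  have h3 := hs (c, 3)
  have e1 : ((0 : ZMod 4) + 1) = 1 := by decide
  have e2 : ((1 : ZMod 4) + 1) = 2 := by decide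
  have e3 : ((2 : ZMod 4) + 1) = 3 := by decide
  have e4 : ((3 : ZMod 4) + 1) = 0 := by decide
  simp only [DiagramCode.rot, e1, e2, e3, e4] at h0 h1 h2 h3
  have hi := zmod4_cases i
  have a1 : (3 : ZMod 4) - 1 = 2 := by decide
  have a2 : (3 : ZMod 4) - 2 = 1 := by decide
  have a3 : (1 : ZMod 4) - 2 = 3 := by decide
  have a4 : (1 : ZMod 4) - 3 = 2 := by decide
  have two : ∀ a : ZMod 2, a + 1 + 1 = a := by decide
  rcases hi with rfl | rfl | rfl | rfl <;> by_cases hc : c ∈ x <;>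
    simp [smooth, hc, a1, a2, a3, a4, h0, h1, h2, two]

lemma sameCircle_iff_sameCycle {s : D.Dart → ZMod 2} (h1 : ∀ h, s (D.opp h) = s h + 1)
    (h2 : ∀ h, s (D.rot h) = s h + 1) (x : Finset D.Crossing) {a b : D.Dart} (hab : s a = s b) :
    D.sameCircle x (Sum.inl a) (Sum.inl b) ↔ (D.travel x).SameCycle a b := by
  classical
  have h3 := D.smooth_parity h2 x
  constructor
  · intro h
    let κ : D.Arc → Quotient (Equiv.Perm.SameCycle.setoid (D.travel x)) ⊕ Fin D.freeCircles :=
      Sum.map (fun h => Quotient.mk _ (if s h = s a then h else D.opp h)) id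
    have key : D.sameCircle x ≤ Setoid.ker κ := by
      rw [sameCircle_le_iff]
      rintro _ _ (h | h)
      · change Sum.inl _ = Sum.inl _
        congr 1
        dsimp only
        rw [h1]
        by_cases hh : s h = s a
        · simp [hh, D.opp_opp]
        · have : s h + 1 = s a := by revert hh; generalize s h = u; generalize s a = v
                                     revert u v; decide
          simp [hh, this]
      · change Sum.inl _ = Sum.inl _
        congr 1
        dsimp only
        rw [h3]
        by_cases hh : s h = s a
        · simp only [hh, if_true]
          rw [if_neg (by simp)]
          refine Quotient.sound (Equiv.Perm.SameCycle.symm ⟨1, ?_⟩)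
          simp [travel, D.opp_opp, D.smooth_smooth]
        · have : s h + 1 = s a := by revert hh; generalize s h = u; generalize s a = v
                                     revert u v; decide
          simp only [hh, this, if_true, if_false]
          refine Quotient.sound ⟨1, ?_⟩
          simp [travel, D.opp_opp]
    have := key h
    change Sum.inl _ = Sum.inl _ at this
    have := Quotient.exact (Sum.inl_injective this)
    simp only [hab, if_true] at this
    exact this
  · intro h
    obtain ⟨n, rfl⟩ := h.exists_nat_pow_eq
    clear hab h
    induction n with
    | zero => exact (D.sameCircle x).refl _
    | succ n ih =>
      refine (D.sameCircle x).trans ih ?_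
      rw [pow_succ', Equiv.Perm.mul_apply]
      exact (D.sameCircle x).trans (D.same_opp x _) (D.same_smooth x _)

/-- Exactly one of the two resolutions of a crossing has both its arcs on the same circle. -/
lemma merge_or_split {y : Finset D.Crossing} {c : D.Crossing} (hc : c ∉ y) :
    D.sameCircle y (D.armP c) (D.armQ c) ↔ ¬ D.sameCircle (insert c y) (D.armP c) (D.armQ c) := by
  obtain ⟨s, h1, h2⟩ := D.exists_sourceSink
  have two : ∀ a : ZMod 2, a + 1 + 1 = a := by decide
  have e1 : ((0 : ZMod 4) + 1) = 1 := by decide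
  have e2 : ((1 : ZMod 4) + 1) = 2 := by decide
  have e3 : ((2 : ZMod 4) + 1) = 3 := by decide
  have hs1 : s (c, 1) = s (c, 0) + 1 := by rw [← h2, DiagramCode.rot, e1]
  have hs2 : s (c, 2) = s (c, 0) := by rw [← e2, ← two (s (c, 0)), ← hs1]; exact h2 (c, 1)
  have hs3 : s (c, 3) = s (c, 0) + 1 := by rw [← hs2, ← h2, DiagramCode.rot, e3]
  unfold armP armQ
  rw [D.sameCircle_iff_sameCycle h1 h2 _ hs2.symm, D.sameCircle_iff_sameCycle h1 h2 _ hs2.symm]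
  refine sameCycle_iff_not_of_swap (by simp; decide) (fun h => s h = s (c, 0)) ?_ rfl ?_
  · intro h hh
    change s (D.smooth _ _) = _
    rw [D.smooth_parity h2, h1, two, hh]
  · intro h hh
    change D.smooth _ (D.opp h) = Equiv.swap _ _ (D.smooth _ (D.opp h))
    have hp := h1 h
    rw [hh] at hp
    generalize D.opp h = k at hp
    obtain ⟨d, i⟩ := k
    by_cases hd : d = c
    · subst hd
      have hi := zmod4_cases i
      have a1 : (3 : ZMod 4) - 1 = 2 := by decide
      have a4 : (1 : ZMod 4) - 3 = 2 := by decide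
      rcases hi with rfl | rfl | rfl | rfl
      · simp at hp
      · simp [smooth, hc, a1]
      · rw [hs2] at hp; simp at hp
      · simp [smooth, hc, a4]
    · rw [Equiv.swap_apply_of_ne_of_ne]
      · simp [smooth, hd]
      · simp [smooth, hd]
      · simp [smooth, hd]

/-- In a merge, the circles through the crossing are glued. -/
lemma sameCircle_insert_of_merge {y : Finset D.Crossing} {c : D.Crossing} (hc : c ∉ y)
    (h : ¬ D.sameCircle y (D.armP c) (D.armQ c)) :
    D.sameCircle (insert c y) = glue (D.sameCircle y) (D.armP c) (D.armQ c) := by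
  rw [D.glue_eq_glue, glue_eq_self]
  by_contra h'
  exact h ((D.merge_or_split hc).2 h')

/-- In a split, the circle through the crossing comes from gluing the two new ones. -/
lemma sameCircle_of_split {y : Finset D.Crossing} {c : D.Crossing}
    (h : D.sameCircle y (D.armP c) (D.armQ c)) :
    D.sameCircle y = glue (D.sameCircle (insert c y)) (D.armP c) (D.armQ c) := by
  rw [← D.glue_eq_glue, glue_eq_self h]

end LinkDiagram

/-! ### The Khovanov cube -/

/-- The Frobenius algebra `V = R[1, u]` with `u * u = 0`: the dual numbers over `R`, which are free
over `R` on `1` and `u`. Khovanov homology uses `R = ℤ`. -/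
def FrobV (R : Type) [CommRing R] : Type := DualNumber R

namespace FrobV

variable {R : Type} [CommRing R]

noncomputable instance : CommRing (FrobV R) := inferInstanceAs (CommRing (DualNumber R))
noncomputable instance : Algebra R (FrobV R) := inferInstanceAs (Algebra R (DualNumber R))

/-- The generator `u` of `V`. -/
def u : FrobV R := (DualNumber.eps : DualNumber R)

/-- The coefficient of `1`. -/
def coeffOne : FrobV R →ₗ[R] R := (TrivSqZeroExt.fstHom R R R).toLinearMap

/-- The coefficient of `u`. -/
def coeffU : FrobV R →ₗ[R] R := TrivSqZeroExt.sndHom R R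

/-- The comultiplication of `V`: it sends `1` to `1 ⊗ u + u ⊗ 1` and `u` to `u ⊗ u`. -/
noncomputable def comul : FrobV R →ₗ[R] FrobV R ⊗[R] FrobV R :=
  coeffOne.smulRight (1 ⊗ₜ[R] u + u ⊗ₜ[R] 1) + coeffU.smulRight (u ⊗ₜ[R] u)

lemma coeffOne_one : coeffOne (1 : FrobV R) = 1 :=
  TrivSqZeroExt.fst_one (R := R) (M := R)
lemma coeffU_one : coeffU (1 : FrobV R) = 0 :=
  TrivSqZeroExt.snd_one (R := R) (M := R)
lemma coeffOne_u : coeffOne (u : FrobV R) = 0 :=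
  TrivSqZeroExt.fst_inr R (1 : R)
lemma coeffU_u : coeffU (u : FrobV R) = 1 :=
  TrivSqZeroExt.snd_inr R (1 : R)

lemma comul_one : comul (1 : FrobV R) = 1 ⊗ₜ u + u ⊗ₜ 1 := by
  simp [comul, coeffOne_one, coeffU_one]

lemma comul_u : comul (u : FrobV R) = u ⊗ₜ u := by simp [comul, coeffOne_u, coeffU_u]

lemma u_mul_u : (u : FrobV R) * u = 0 := DualNumber.eps_mul_eps

lemma eq_add (v : FrobV R) : v = coeffOne v • (1 : FrobV R) + coeffU v • u := by
  change (v : DualNumber R) = (v : DualNumber R).fst • (1 : DualNumber R) +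
    (v : DualNumber R).snd • (DualNumber.eps : DualNumber R)
  apply TrivSqZeroExt.ext <;> simp

lemma comul_u_mul (v : FrobV R) : comul (u * v) = (u ⊗ₜ[R] (1 : FrobV R)) * comul v ∧
    comul (u * v) = ((1 : FrobV R) ⊗ₜ[R] u) * comul v := by
  rw [eq_add v]
  simp [mul_add, u_mul_u, comul_one, comul_u]

end FrobV

namespace LinkDiagram

variable (D : LinkDiagram)
variable (R : Type) [CommRing R]

instance (x : Finset D.Crossing) : Finite (D.Circle x) :=
  Finite.of_surjective (D.circle x) Quotient.mk_surjective
noncomputable instance (x : Finset D.Crossing) : Fintype (D.Circle x) := Fintype.ofFinite _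
noncomputable instance (x : Finset D.Crossing) : DecidableEq (D.Circle x) := Classical.decEq _

/-- The group `V ⊗ ⋯ ⊗ V` at the vertex `x` of the cube: one factor for each circle of `D(x)`. -/
abbrev Vertex (x : Finset D.Crossing) : Type := ⨂[R] _ : D.Circle x, FrobV R

/-- The inclusion `v ↦ 1 ⊗ ⋯ ⊗ v ⊗ ⋯ ⊗ 1` of the tensor factor of the circle `C`. -/
noncomputable def factor (x : Finset D.Crossing) (C : D.Circle x) : FrobV R →ₐ[R] D.Vertex R x :=
  PiTensorProduct.singleAlgHom (R := R) (A := fun _ : D.Circle x => FrobV R) C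

/-- The inclusion `v ⊗ w ↦ 1 ⊗ ⋯ ⊗ v ⊗ ⋯ ⊗ w ⊗ ⋯ ⊗ 1` of the tensor factors of two circles. -/
noncomputable def factor₂ (x : Finset D.Crossing) (C C' : D.Circle x) :
    FrobV R ⊗[R] FrobV R →ₐ[R] D.Vertex R x :=
  Algebra.TensorProduct.productMap (D.factor R x C) (D.factor R x C')

open scoped Classical in
/-- Where the factor of the circle `C` of `D(y)` goes when the resolution of the crossing `c` is
changed from `0` in `D(y)` to `1` in `D(x)`. If both arcs at `c` lie on one circle of `D(y)`, and
`C` is this circle, then `C` bifurcates into the two circles of `D(x)` through `c`, and the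
comultiplication is used. In all other cases the factor `V` of `C` is mapped identically onto the
factor of the circle of `D(x)` into which `C` is carried. -/
noncomputable def edgeFactor (c : D.Crossing) (y x : Finset D.Crossing) (C : D.Circle y) :
    FrobV R →ₗ[R] D.Vertex R x :=
  if D.circle y (D.armP c) = D.circle y (D.armQ c) ∧ C = D.circle y (D.armP c) then
    (D.factor₂ R x (D.circle x (D.armP c)) (D.circle x (D.armQ c))).toLinearMap ∘ₗ FrobV.comul
  else (D.factor R x (D.circle x (Quotient.out C))).toLinearMap

/-- The map of the edge from `y` to `x = y ∪ {c}`, `c ∉ y`, of the Khovanov cube: the factors are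
mapped by `edgeFactor` and the results are multiplied in `V ⊗ ⋯ ⊗ V`. If the two circles through
`c` are fused, both of their factors are mapped to the factor of the new circle, so that this is
the multiplication of `V` on them; if a circle bifurcates this is the comultiplication on it; and it
is the identity on the factors of the other circles. -/
noncomputable def edgeMap (c : D.Crossing) (y x : Finset D.Crossing) :
    D.Vertex R y →ₗ[R] D.Vertex R x :=
  PiTensorProduct.lift
    ((MultilinearMap.mkPiAlgebra R (D.Circle y) (D.Vertex R x)).compLinearMap (D.edgeFactor R c y x))

lemma edgeMap_tprod (c : D.Crossing) (y x : Finset D.Crossing) (v : D.Circle y → FrobV R) :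
    D.edgeMap R c y x (PiTensorProduct.tprod R v) = ∏ C, D.edgeFactor R c y x C (v C) := by
  simp [edgeMap]

/-! The cube is functorial. -/

/-- The polynomial ring on the arcs acts on every vertex through the elements `u`. -/
noncomputable def act (x : Finset D.Crossing) : MvPolynomial D.Arc R →ₐ[R] D.Vertex R x :=
  MvPolynomial.aeval fun e => D.factor R x (D.circle x e) FrobV.u

lemma act_X (x : Finset D.Crossing) (e : D.Arc) :
    D.act R x (MvPolynomial.X e) = D.factor R x (D.circle x e) FrobV.u := by simp [act]

lemma circle_eq {x : Finset D.Crossing} {e f : D.Arc} :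
    D.circle x e = D.circle x f ↔ D.sameCircle x e f := Quotient.eq

lemma circle_out {x : Finset D.Crossing} (C : D.Circle x) : D.circle x (Quotient.out C) = C :=
  Quotient.out_eq C

lemma tprod_eq_prod (x : Finset D.Crossing) (v : D.Circle x → FrobV R) :
    PiTensorProduct.tprod R v = ∏ C, D.factor R x C (v C) := by
  simp only [factor, PiTensorProduct.singleAlgHom_apply]
  rw [← PiTensorProduct.tprod_prod]
  congr 1
  funext C
  simp [MonoidHom.mulSingle_apply]

lemma act_surjective (x : Finset D.Crossing) : Function.Surjective (D.act R x) := by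
  have hf : ∀ C v, D.factor R x C v ∈ (D.act R x).range := by
    intro C v
    rw [FrobV.eq_add v, map_add, map_smul, map_smul, map_one]
    have : D.factor R x C FrobV.u ∈ (D.act R x).range :=
      ⟨MvPolynomial.X (Quotient.out C), (D.act_X R _ _).trans (by rw [circle_out])⟩
    exact add_mem (Subalgebra.smul_mem _ (one_mem _) _) (Subalgebra.smul_mem _ this _)
  intro t
  have : t ∈ (D.act R x).range := by
    induction t using PiTensorProduct.induction_on with
    | smul_tprod r v =>
      refine Subalgebra.smul_mem _ ?_ r
      rw [tprod_eq_prod]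
      exact prod_mem fun C _ => hf C _
    | add a b ha hb => exact add_mem ha hb
  exact this

lemma act_X_congr {x : Finset D.Crossing} {e f : D.Arc} (h : D.sameCircle x e f) :
    D.act R x (MvPolynomial.X e) = D.act R x (MvPolynomial.X f) := by
  rw [act_X, act_X, D.circle_eq.2 h]

open scoped Classical in
/-- The multiplier of an edge: the handle element for a split and `1` for a merge. -/
noncomputable def mult (c : D.Crossing) (y : Finset D.Crossing) : MvPolynomial D.Arc R :=
  if D.sameCircle y (D.armP c) (D.armQ c) then
    MvPolynomial.X (D.armP c) + MvPolynomial.X (D.armQ c) else 1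

lemma edgeFactor_u_mul {c : D.Crossing} {y : Finset D.Crossing} (hc : c ∉ y) (e : D.Arc)
    (v : FrobV R) :
    D.edgeFactor R c y (insert c y) (D.circle y e) (FrobV.u * v) =
      D.act R (insert c y) (MvPolynomial.X e) * D.edgeFactor R c y (insert c y) (D.circle y e) v := by
  unfold edgeFactor
  split_ifs with h
  · obtain ⟨h1, h2⟩ := h
    rw [circle_eq] at h1 h2
    have hx := h2
    rw [D.sameCircle_of_split h1] at hx
    have hx' : D.sameCircle (insert c y) e (D.armP c) ∨ D.sameCircle (insert c y) e (D.armQ c) := by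
      rcases hx with hx | hx
      · exact Or.inl hx
      · exact hx.1
    simp only [LinearMap.comp_apply, AlgHom.toLinearMap_apply]
    rcases hx' with hx | hx
    · rw [(FrobV.comul_u_mul v).1, map_mul, D.act_X_congr R hx, D.act_X R]
      simp [factor₂]
    · rw [(FrobV.comul_u_mul v).2, map_mul, D.act_X_congr R hx, D.act_X R]
      simp [factor₂]
  · have he : D.sameCircle y (Quotient.out (D.circle y e)) e := D.circle_eq.1 (D.circle_out _)
    generalize Quotient.out (D.circle y e) = e' at he ⊢
    have : D.sameCircle (insert c y) e' e := by
      by_cases h1 : D.sameCircle y (D.armP c) (D.armQ c)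
      · have h2 : ¬ D.sameCircle y e (D.armP c) := fun h2 =>
          h ⟨D.circle_eq.2 h1, D.circle_eq.2 h2⟩
        have he' := he
        rw [D.sameCircle_of_split h1] at he'
        rcases he' with he' | ⟨_, he'⟩
        · exact he'
        · exfalso
          apply h2
          rw [D.sameCircle_of_split h1]
          exact Or.inr ⟨he', Or.inl ((D.sameCircle (insert c y)).refl _)⟩
      · rw [D.sameCircle_insert_of_merge hc h1]
        exact le_glue _ _ _ he
    rw [D.circle_eq.2 this, act_X]
    simp

lemma edgeMap_act_mul {c : D.Crossing} {y : Finset D.Crossing} (hc : c ∉ y) (e : D.Arc)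
    (t : D.Vertex R y) : D.edgeMap R c y (insert c y) (D.act R y (MvPolynomial.X e) * t) =
      D.act R (insert c y) (MvPolynomial.X e) * D.edgeMap R c y (insert c y) t := by
  induction t using PiTensorProduct.induction_on with
  | smul_tprod r v =>
    rw [mul_smul_comm, map_smul, map_smul, mul_smul_comm]
    congr 1
    rw [act_X, factor, PiTensorProduct.singleAlgHom_apply, PiTensorProduct.tprod_mul_tprod]
    rw [edgeMap_tprod, edgeMap_tprod, ← Finset.mul_prod_erase _ _ (Finset.mem_univ (D.circle y e)),
      ← Finset.mul_prod_erase Finset.univ (fun C => D.edgeFactor R c y (insert c y) C (v C))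
        (Finset.mem_univ (D.circle y e)), ← mul_assoc, ← D.edgeFactor_u_mul R hc]
    congr 1
    · simp
    · refine Finset.prod_congr rfl fun C hC => ?_
      simp [Pi.mulSingle_eq_of_ne (Finset.ne_of_mem_erase hC)]
  | add a b ha hb => rw [mul_add, map_add, map_add, mul_add, ha, hb]

lemma edgeMap_one (c : D.Crossing) (y x : Finset D.Crossing) :
    D.edgeMap R c y x 1 = D.act R x (D.mult R c y) := by
  rw [PiTensorProduct.one_def, edgeMap_tprod]
  unfold mult
  split_ifs with h
  · rw [← Finset.mul_prod_erase _ _ (Finset.mem_univ (D.circle y (D.armP c))),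
      Finset.prod_eq_one, mul_one]
    · rw [edgeFactor, if_pos ⟨D.circle_eq.2 h, rfl⟩, map_add, act_X, act_X]
      simp [FrobV.comul_one, factor₂, add_comm]
    · intro C hC
      rw [edgeFactor, if_neg (fun h => Finset.ne_of_mem_erase hC h.2)]
      simp
  · rw [map_one]
    refine Finset.prod_eq_one fun C _ => ?_
    rw [edgeFactor, if_neg (fun h' => h (D.circle_eq.1 h'.1))]
    simp

lemma edgeMap_act {c : D.Crossing} {y : Finset D.Crossing} (hc : c ∉ y)
    (p : MvPolynomial D.Arc R) :
    D.edgeMap R c y (insert c y) (D.act R y p) = D.act R (insert c y) (p * D.mult R c y) := by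
  rw [map_mul]
  induction p using MvPolynomial.induction_on with
  | C a =>
    have : ∀ x, D.act R x (MvPolynomial.C a) = a • 1 := fun x => by
      rw [act, MvPolynomial.aeval_C]; simp [Algebra.algebraMap_eq_smul_one]
    rw [this, this, map_smul, edgeMap_one, smul_one_mul]
  | add p q hp hq => rw [map_add, map_add, hp, hq, map_add, add_mul]
  | mul_X p e hp => rw [map_mul, mul_comm, D.edgeMap_act_mul R hc, hp, map_mul]; ring

lemma edgeMap_act' {c : D.Crossing} {y x : Finset D.Crossing} (hc : c ∉ y) (hx : insert c y = x)
    (p : MvPolynomial D.Arc R) :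
    D.edgeMap R c y x (D.act R y p) = D.act R x (p * D.mult R c y) := by
  subst hx
  exact D.edgeMap_act R hc p

lemma card_circle {c : D.Crossing} {y : Finset D.Crossing} (hc : c ∉ y) :
    (D.sameCircle y (D.armP c) (D.armQ c) ∧
      Nat.card (D.Circle (insert c y)) = Nat.card (D.Circle y) + 1) ∨
    (¬ D.sameCircle y (D.armP c) (D.armQ c) ∧
      Nat.card (D.Circle y) = Nat.card (D.Circle (insert c y)) + 1) := by
  by_cases h : D.sameCircle y (D.armP c) (D.armQ c)
  · refine Or.inl ⟨h, ?_⟩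
    unfold Circle
    rw [card_glue ((D.merge_or_split hc).1 h), ← D.sameCircle_of_split h]
  · refine Or.inr ⟨h, ?_⟩
    unfold Circle
    rw [card_glue h, ← D.sameCircle_insert_of_merge hc h]

/-- The multipliers along the two ways around a square agree. -/
lemma mult_square {c d : D.Crossing} {y : Finset D.Crossing} (hc : c ∉ y) (hd : d ∉ y)
    (hcd : c ≠ d) :
    D.act R (insert d (insert c y)) (D.mult R c y * D.mult R d (insert c y)) =
      D.act R (insert d (insert c y)) (D.mult R d y * D.mult R c (insert d y)) := by
  have hd' : d ∉ insert c y := by simp [hd, hcd.symm]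
  have hc' : c ∉ insert d y := by simp [hc, hcd]
  have k1 := D.card_circle hc
  have k2 := D.card_circle hd
  have k3 := D.card_circle hd'
  have k4 := D.card_circle hc'
  rw [Finset.insert_comm c d y] at k4
  set x := insert d (insert c y) with hx
  have fin : ∀ {z : Finset D.Crossing}, D.sameCircle z ≤ D.sameCircle x →
      (D.sameCircle z (D.armP c) (D.armP d) ∧ D.sameCircle z (D.armQ c) (D.armQ d)) ∨
      (D.sameCircle z (D.armP c) (D.armQ d) ∧ D.sameCircle z (D.armQ c) (D.armP d)) →
      D.act R x (MvPolynomial.X (D.armP c) + MvPolynomial.X (D.armQ c)) =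
      D.act R x (MvPolynomial.X (D.armP d) + MvPolynomial.X (D.armQ d)) := by
    rintro z hz (⟨h1, h2⟩ | ⟨h1, h2⟩)
    · rw [map_add, map_add, D.act_X_congr R (hz h1), D.act_X_congr R (hz h2)]
    · rw [map_add, map_add, D.act_X_congr R (hz h1), D.act_X_congr R (hz h2), add_comm]
  unfold mult
  by_cases a1 : D.sameCircle y (D.armP c) (D.armQ c) <;>
  by_cases a2 : D.sameCircle y (D.armP d) (D.armQ d) <;>
  by_cases a3 : D.sameCircle (insert c y) (D.armP d) (D.armQ d) <;>
  by_cases a4 : D.sameCircle (insert d y) (D.armP c) (D.armQ c) <;>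
  simp only [a1, a2, a3, a4, if_true, if_false, one_mul, mul_one, not_true, not_false_iff,
    true_and, false_and, or_false, false_or] at k1 k2 k3 k4 ⊢ <;>
  first
    | omega
    | skip
  · rw [mul_comm]
  · -- both crossings split first and merge last
    have hg : glue (D.sameCircle (insert c y)) (D.armP c) (D.armQ c) (D.armP d) (D.armQ d) := by
      rw [← D.sameCircle_of_split a1]; exact a2
    have hle : D.sameCircle (insert c y) ≤ D.sameCircle x := by
      rw [hx, D.sameCircle_insert_of_merge hd' a3]; exact le_glue _ _ _
    exact (fin hle (by
      rcases pair_eq_of_glue a3 hg with ⟨h1, h2⟩ | ⟨h1, h2⟩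
      · exact Or.inl ⟨(D.sameCircle _).symm h1, (D.sameCircle _).symm h2⟩
      · exact Or.inr ⟨(D.sameCircle _).symm h2, (D.sameCircle _).symm h1⟩))
  · -- both crossings merge first and split last
    have hn : ¬ D.sameCircle x (D.armP c) (D.armQ c) := by
      have := (D.merge_or_split hc').1 a4
      rwa [Finset.insert_comm] at this
    have hg : glue (D.sameCircle x) (D.armP d) (D.armQ d) (D.armP c) (D.armQ c) := by
      rw [hx, ← D.sameCircle_of_split a3, D.sameCircle_insert_of_merge hc a1]
      exact glue_rel _ _ _
    exact (fin le_rfl (pair_eq_of_glue hn hg)).symm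

/-- The square faces of the Khovanov cube commute. -/
lemma edgeMap_square {c d : D.Crossing} {y : Finset D.Crossing} (hc : c ∉ y) (hd : d ∉ y)
    (hcd : c ≠ d) :
    D.edgeMap R d (insert c y) (insert d (insert c y)) ∘ₗ D.edgeMap R c y (insert c y) =
      D.edgeMap R c (insert d y) (insert d (insert c y)) ∘ₗ D.edgeMap R d y (insert d y) := by
  ext1
  ext v
  obtain ⟨p, hp⟩ := D.act_surjective R y (PiTensorProduct.tprod R v)
  have hd' : d ∉ insert c y := by simp [hd, hcd.symm]
  have hc' : c ∉ insert d y := by simp [hc, hcd]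
  simp only [LinearMap.compMultilinearMap_apply, LinearMap.comp_apply]
  rw [← hp, D.edgeMap_act' R hc rfl, D.edgeMap_act' R hd' rfl, D.edgeMap_act' R hd rfl,
    D.edgeMap_act' R hc' (Finset.insert_comm c d y), mul_assoc, mul_assoc, map_mul,
    D.mult_square R hc hd hcd, ← map_mul]

/-- The composite of the edge maps along a maximal chain of subsets from `y` up to `x`. -/
inductive IsChainMap : (y x : Finset D.Crossing) → (D.Vertex R y →ₗ[R] D.Vertex R x) → Prop
  | refl (y : Finset D.Crossing) : IsChainMap y y LinearMap.id
  | step {y z x : Finset D.Crossing} (c : D.Crossing) (hc : c ∉ y) (hz : z = insert c y)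
      (f : D.Vertex R z →ₗ[R] D.Vertex R x) (hf : IsChainMap z x f) :
      IsChainMap y x (f ∘ₗ D.edgeMap R c y z)

lemma IsChainMap.subset {y x : Finset D.Crossing} {f : D.Vertex R y →ₗ[R] D.Vertex R x}
    (h : D.IsChainMap R y x f) : y ⊆ x := by
  induction h with
  | refl y => exact Finset.Subset.refl _
  | step c hc hz f hf ih => subst hz; exact (Finset.subset_insert _ _).trans ih

lemma exists_chainMap {y x : Finset D.Crossing} (h : y ⊆ x) : ∃ f, D.IsChainMap R y x f := by
  induction hn : (x \ y).card generalizing y with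
  | zero =>
    have : y = x := Finset.Subset.antisymm h (Finset.sdiff_eq_empty_iff_subset.1
      (Finset.card_eq_zero.1 hn))
    subst this
    exact ⟨_, .refl _⟩
  | succ n ih =>
    obtain ⟨c, hc⟩ : (x \ y).Nonempty := Finset.card_pos.1 (by omega)
    rw [Finset.mem_sdiff] at hc
    obtain ⟨f, hf⟩ := ih (y := insert c y) (Finset.insert_subset hc.1 h) (by
      rw [Finset.sdiff_insert, Finset.card_erase_of_mem (by simp [hc]), hn]; rfl)
    exact ⟨_, .step c hc.2 rfl f hf⟩

lemma IsChainMap.trans {y z x : Finset D.Crossing} {f : D.Vertex R y →ₗ[R] D.Vertex R z}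
    {g : D.Vertex R z →ₗ[R] D.Vertex R x} (hf : D.IsChainMap R y z f)
    (hg : D.IsChainMap R z x g) : D.IsChainMap R y x (g ∘ₗ f) := by
  induction hf with
  | refl y => exact hg
  | step c hc hz f hf ih => exact .step c hc hz _ (ih hg)

/-- The composite does not depend on the chain. -/
lemma IsChainMap.unique {y x : Finset D.Crossing} {f g : D.Vertex R y →ₗ[R] D.Vertex R x}
    (hf : D.IsChainMap R y x f) (hg : D.IsChainMap R y x g) : f = g := by
  induction hn : (x \ y).card using Nat.strong_induction_on generalizing y with
  | _ n ih =>
    subst hn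
    cases hf with
    | refl =>
      cases hg with
      | refl => rfl
      | step c hc hz g hg =>
        subst hz
        exact absurd (hg.subset _ _ (Finset.mem_insert_self _ _)) hc
    | step c hc hz f hf =>
      subst hz
      cases hg with
      | refl => exact absurd (hf.subset _ _ (Finset.mem_insert_self _ _)) hc
      | step d hd hz g hg =>
        subst hz
        have hcx := hf.subset _ _ (Finset.mem_insert_self _ _)
        have hdx := hg.subset _ _ (Finset.mem_insert_self _ _)
        have hlt : ∀ {a : D.Crossing}, a ∉ y → a ∈ x → (x \ insert a y).card < (x \ y).card := by
          intro a ha hax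
          rw [Finset.sdiff_insert]
          exact Finset.card_erase_lt_of_mem (by simp [ha, hax])
        by_cases hcd : c = d
        · subst hcd
          rw [ih _ (hlt hc hcx) hf hg rfl]
        · obtain ⟨k, hk⟩ := D.exists_chainMap R (y := insert d (insert c y)) (x := x)
            (Finset.insert_subset hdx (hf.subset _ _))
          have hd' : d ∉ insert c y := by simp [hd, Ne.symm hcd]
          have hc' : c ∉ insert d y := by simp [hc, hcd]
          rw [ih _ (hlt hc hcx) hf (.step d hd' rfl k hk) rfl,
            ih _ (hlt hd hdx) hg (.step c hc' (Finset.insert_comm d c y) k hk) rfl,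
            LinearMap.comp_assoc, LinearMap.comp_assoc, D.edgeMap_square R hc hd hcd]

/-- The map of the Khovanov cube from `y` to a larger set `x`: compose the maps of the edges along
any maximal chain of subsets from `y` to `x`. -/
noncomputable def cubeMap {y x : Finset D.Crossing} (h : y ⊆ x) :
    D.Vertex R y →ₗ[R] D.Vertex R x := (D.exists_chainMap R h).choose

lemma cubeMap_eq {y x : Finset D.Crossing} (h : y ⊆ x) {f : D.Vertex R y →ₗ[R] D.Vertex R x}
    (hf : D.IsChainMap R y x f) : D.cubeMap R h = f :=
  IsChainMap.unique D R (D.exists_chainMap R h).choose_spec hf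

lemma cubeMap_refl (y : Finset D.Crossing) :
    D.cubeMap R (Finset.Subset.refl y) = LinearMap.id := D.cubeMap_eq R _ (.refl y)

lemma cubeMap_trans {y z x : Finset D.Crossing} (h : y ⊆ z) (k : z ⊆ x) :
    D.cubeMap R (h.trans k) = D.cubeMap R k ∘ₗ D.cubeMap R h :=
  D.cubeMap_eq R _ (IsChainMap.trans D R (D.exists_chainMap R h).choose_spec
    (D.exists_chainMap R k).choose_spec)

/-- On the edges of the cube this is the edge map. -/
lemma cubeMap_insert {c : D.Crossing} {y : Finset D.Crossing} (hc : c ∉ y) :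
    D.cubeMap R (Finset.subset_insert c y) = D.edgeMap R c y (insert c y) :=
  D.cubeMap_eq R _ (.step c hc rfl _ (.refl _))

end LinkDiagram

/-! ### Presheaves on the Boolean lattice and their cube complexes -/

/-- The Boolean lattice on `A`: the subsets of `A` ordered by reverse inclusion. -/
abbrev BooleanLattice (A : Type) : Type := (Finset A)ᵒᵈ

namespace BooleanLattice

variable {A : Type}

/-- The subset of `A` that underlies an element of the Boolean lattice. -/
def toFinset (x : BooleanLattice A) : Finset A := OrderDual.ofDual x

/-- The element of the Boolean lattice given by a subset of `A`. -/
def of (x : Finset A) : BooleanLattice A := OrderDual.toDual x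

lemma of_le_of {x y : Finset A} : of x ≤ of y ↔ y ⊆ x := Iff.rfl

/-- The morphism `x ⟶ y` for `x ⊇ y`. -/
def homOf {x y : Finset A} (h : y ⊆ x) : of x ⟶ of y := homOfLE (of_le_of.2 h)

end BooleanLattice

/-- The Khovanov presheaf `F_KH` of a link diagram on the Boolean lattice of its crossings. -/
noncomputable def LinkDiagram.khovanovPresheaf (D : LinkDiagram) :
    (BooleanLattice D.Crossing)ᵒᵖ ⥤ AddCommGrpCat.{0} where
  obj x := AddCommGrpCat.of (D.Vertex ℤ x.unop.toFinset)
  map f := AddCommGrpCat.ofHom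
    (D.cubeMap ℤ (BooleanLattice.of_le_of.1 (leOfHom f.unop))).toAddMonoidHom
  map_id x := by
    ext v
    exact LinearMap.congr_fun (D.cubeMap_refl ℤ _) v
  map_comp f g := by
    ext v
    exact LinearMap.congr_fun (D.cubeMap_trans ℤ _ _) v

/-- A choice of a sign `[x, y]` for every edge `x ≺ y` of the cube, `x = y ∪ {c}` with `c ∉ y`
(written `sign y c`), such that every square face has an odd number of minus signs. -/
structure CubeSigns (A : Type) [DecidableEq A] where
  sign : Finset A → A → ℤˣ
  square : ∀ (y : Finset A) (c d : A), c ∉ y → d ∉ y → c ≠ d →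
    sign y c * sign (insert c y) d * (sign y d * sign (insert d y) c) = -1

/-- The standard choice of signs, for a linear order on the crossings. -/
def CubeSigns.standard (A : Type) [LinearOrder A] : CubeSigns A where
  sign y c := (-1) ^ (y.filter (· < c)).card
  square := by
    have key : ∀ (y : Finset A) (c d : A), c ∉ y → d ∉ y → c < d →
        (-1 : ℤˣ) ^ (y.filter (· < c)).card * (-1) ^ ((insert c y).filter (· < d)).card *
        ((-1) ^ (y.filter (· < d)).card * (-1) ^ ((insert d y).filter (· < c)).card) = -1 := by
      intro y c d hc hd h
      rw [Finset.filter_insert, if_pos h, Finset.filter_insert, if_neg h.not_gt,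
        Finset.card_insert_of_notMem (by simp [hc]), pow_succ]
      have h1 := Int.units_mul_self ((-1 : ℤˣ) ^ (y.filter (· < c)).card)
      have h2 := Int.units_mul_self ((-1 : ℤˣ) ^ (y.filter (· < d)).card)
      generalize (-1 : ℤˣ) ^ (y.filter (· < c)).card = p at *
      generalize (-1 : ℤˣ) ^ (y.filter (· < d)).card = q at *
      calc p * (q * -1) * (q * p) = -((p * p) * (q * q)) := by
            rw [mul_neg_one]; simp only [mul_neg, neg_mul]; congr 1
            rw [mul_comm q p, mul_mul_mul_comm]
        _ = -1 := by rw [h1, h2, one_mul]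
    intro y c d hc hd hcd
    rcases lt_or_gt_of_ne hcd with h | h
    · exact key y c d hc hd h
    · rw [mul_comm]
      exact key y d c hd hc h

instance (A : Type) [inst : DecidableEq A] : Nonempty (CubeSigns A) := by
  classical
  let _ : LinearOrder A := linearOrderOfSTO (WellOrderingRel (α := A))
  have h : inst = (fun a b => LinearOrder.toDecidableEq a b) := Subsingleton.elim _ _
  rw [h]
  exact ⟨CubeSigns.standard A⟩

section CubeComplex

variable {A : Type} (F : (BooleanLattice A)ᵒᵖ ⥤ AddCommGrpCat.{0})

/-- The value of a presheaf on the Boolean lattice at a subset of `A`. -/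
abbrev cubeObj (x : Finset A) : AddCommGrpCat.{0} := F.obj (Opposite.op (BooleanLattice.of x))

/-- The map of a presheaf on the Boolean lattice from a subset of `A` to a larger one. -/
abbrev cubeHom {y x : Finset A} (h : y ⊆ x) : cubeObj F y →+ cubeObj F x :=
  (F.map (BooleanLattice.homOf h).op).hom

lemma cubeHom_trans {y z x : Finset A} (h : y ⊆ z) (k : z ⊆ x) (a : cubeObj F y) :
    cubeHom F k (cubeHom F h a) = cubeHom F (h.trans k) a := by
  have : (BooleanLattice.homOf (h.trans k)).op =
    (BooleanLattice.homOf h).op ≫ (BooleanLattice.homOf k).op := rfl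
  unfold cubeHom
  rw [this, F.map_comp]
  rfl

/-- The subsets of `A` of size `n`, that is, a row of the cube. -/
abbrev Row (A : Type) (n : ℕ) : Type := {x : Finset A // x.card = n}

lemma cubeHom_congr {n : ℕ} {x : Finset A} (a : ∀ x : Row A n, cubeObj F x.1) {y z : Row A n} (h : y = z)
    (hy : y.1 ⊆ x) (hz : z.1 ⊆ x) : cubeHom F hy (a y) = cubeHom F hz (a z) := by
  subst h; rfl

variable [DecidableEq A] (ε : CubeSigns A)

/-- Removing an element from a member of a row. -/
def Row.erase {n : ℕ} (x : Row A (n + 1)) (c : x.1) : Row A n :=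
  ⟨x.1.erase c.1, by rw [Finset.card_erase_of_mem c.2, x.2]; rfl⟩

lemma Row.erase_subset {n : ℕ} (x : Row A (n + 1)) (c : x.1) : (x.erase c).1 ⊆ x.1 :=
  Finset.erase_subset _ _

/-- The `n`-cochains: the direct sum (for finite `A` this is the product) of the values of `F` on
the subsets of size `n`. -/
abbrev CubeCochain (n : ℕ) : Type := ∀ x : Row A n, cubeObj F x.1

/-- The differential: the sum of the signed maps `[x, y] F(x ≺ y)` over all edges `x ≺ y` from row
`n` to row `n + 1`. -/
def cubeD (n : ℕ) : CubeCochain F n →+ CubeCochain F (n + 1) where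
  toFun a x := ∑ c : x.1, ε.sign (x.erase c).1 c.1 • cubeHom F (x.erase_subset c) (a (x.erase c))
  map_zero' := by funext x; simp
  map_add' a b := by funext x; simp [Finset.sum_add_distrib]

lemma cubeD_comp (n : ℕ) (a : CubeCochain F n) : cubeD F ε (n + 1) (cubeD F ε n a) = 0 := by
  funext x
  have hterm : ∀ (c : x.1) (d : (x.erase c).1), ((x.erase c).erase d).1 ⊆ x.1 := fun c d =>
    ((x.erase c).erase_subset d).trans (x.erase_subset c)
  have h1 : cubeD F ε (n + 1) (cubeD F ε n a) x = ∑ c : x.1, ∑ d : (x.erase c).1,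
      (ε.sign (x.erase c).1 c.1 * ε.sign ((x.erase c).erase d).1 d.1) •
        cubeHom F (hterm c d) (a ((x.erase c).erase d)) := by
    change ∑ c : x.1, ε.sign (x.erase c).1 c.1 • cubeHom F (x.erase_subset c)
      (∑ d : (x.erase c).1, ε.sign ((x.erase c).erase d).1 d.1 •
        cubeHom F ((x.erase c).erase_subset d) (a ((x.erase c).erase d))) = _
    refine Finset.sum_congr rfl fun c _ => ?_
    rw [map_sum, Finset.smul_sum]
    refine Finset.sum_congr rfl fun d _ => ?_
    rw [mul_smul, ← cubeHom_trans F ((x.erase c).erase_subset d) (x.erase_subset c)]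
    congr 1
    simp only [Units.smul_def]
    exact map_zsmul _ _ _
  rw [h1, Finset.sum_sigma']
  have hd1 : ∀ p : (Σ c : x.1, (x.erase c).1), p.2.1 ≠ p.1.1 ∧ p.2.1 ∈ x.1 := fun p =>
    Finset.mem_erase.1 p.2.2
  refine Finset.sum_involution
    (fun p _ => ⟨⟨p.2.1, (hd1 p).2⟩, ⟨p.1.1, Finset.mem_erase.2 ⟨(hd1 p).1.symm, p.1.2⟩⟩⟩)
    ?_ ?_ (fun _ _ => Finset.mem_univ _) (fun _ _ => rfl)
  · rintro ⟨⟨c, hc⟩, ⟨d, hd⟩⟩ -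
    obtain ⟨hdc, hdx⟩ := Finset.mem_erase.1 hd
    have e : (x.1.erase d).erase c = (x.1.erase c).erase d := Finset.erase_right_comm
    have hs := ε.square ((x.1.erase c).erase d) c d (by simp) (by simp) hdc.symm
    have i1 : insert d ((x.1.erase c).erase d) = x.1.erase c := Finset.insert_erase hd
    have i2 : insert c ((x.1.erase c).erase d) = x.1.erase d := by
      rw [← e]; exact Finset.insert_erase (Finset.mem_erase.2 ⟨hdc.symm, hc⟩)
    rw [i1, i2] at hs
    dsimp only
    rw [cubeHom_congr F a (y := (x.erase ⟨d, hdx⟩).erase ⟨c, Finset.mem_erase.2 ⟨hdc.symm, hc⟩⟩)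
      (z := (x.erase ⟨c, hc⟩).erase ⟨d, hd⟩) (Subtype.ext e) _ (hterm ⟨c, hc⟩ ⟨d, hd⟩)]
    generalize cubeHom F (hterm ⟨c, hc⟩ ⟨d, hd⟩) (a ((x.erase ⟨c, hc⟩).erase ⟨d, hd⟩)) = t
    simp only [Row.erase]
    rw [e]
    have hab : ∀ p q r s : ℤˣ, p * q * (r * s) = -1 → s * r = -(q * p) := by decide
    rw [hab _ _ _ _ hs, Units.neg_smul, neg_add_cancel]
  · rintro ⟨⟨c, hc⟩, ⟨d, hd⟩⟩ - _ h
    exact (Finset.mem_erase.1 hd).1 (congrArg (fun p => p.1.1) h)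

/-- The cochain complex of a presheaf on the Boolean lattice. -/
noncomputable def cubeComplex : CochainComplex AddCommGrpCat.{0} ℕ :=
  CochainComplex.of (fun n => AddCommGrpCat.of (CubeCochain F n))
    (fun n => AddCommGrpCat.ofHom (cubeD F ε n))
    (fun n => AddCommGrpCat.hom_ext (AddMonoidHom.ext fun a => cubeD_comp F ε n a))

end CubeComplex

/-- The unnormalised Khovanov homology of a link diagram: the homology of the Khovanov complex
(for a given choice of the signs in the cube). -/
noncomputable def LinkDiagram.unnormalisedKh (D : LinkDiagram) (ε : CubeSigns D.Crossing) (i : ℕ) :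
    AddCommGrpCat.{0} :=
  (cubeComplex D.khovanovPresheaf ε).homology i

/-! ### The modified Boolean lattice -/

/-- The Boolean lattice with an additional element `extra` (written `1'`). -/
inductive ModifiedLattice (A : Type) : Type
  | cell (x : BooleanLattice A)
  | extra

namespace ModifiedLattice

variable {A : Type}

/-- The additional element lies above all elements of the Boolean lattice but the maximal one,
which is the empty subset of `A`. -/
protected def LE : ModifiedLattice A → ModifiedLattice A → Prop
  | cell x, cell y => x ≤ y
  | cell x, extra => x ≠ BooleanLattice.of ∅
  | extra, cell _ => False
  | extra, extra => True

instance : PartialOrder (ModifiedLattice A) where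
  le := ModifiedLattice.LE
  le_refl x := by cases x <;> simp [ModifiedLattice.LE]
  le_trans x y z h k := by
    cases x <;> cases y <;> cases z <;> simp only [ModifiedLattice.LE] at h k ⊢
    · exact h.trans k
    · rintro rfl
      exact k (le_antisymm (Finset.empty_subset _) h)
    · exact h
  le_antisymm x y h k := by
    cases x <;> cases y <;> simp only [ModifiedLattice.LE] at h k ⊢
    exact congrArg cell (le_antisymm h k)

variable (F : (BooleanLattice A)ᵒᵖ ⥤ AddCommGrpCat.{0})

/-- The values of the extended presheaf. -/
def extObj : ModifiedLattice A → AddCommGrpCat.{0}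
  | cell x => F.obj (Opposite.op x)
  | extra => AddCommGrpCat.of PUnit

/-- The maps of the extended presheaf. -/
def extMap : ∀ {x y : ModifiedLattice A}, x ≤ y → (extObj F y ⟶ extObj F x)
  | cell _, cell _, h => F.map (homOfLE (show _ ≤ _ from h)).op
  | cell _, extra, _ => 0
  | extra, extra, _ => 0

/-- The extension of a presheaf on the Boolean lattice by the value `0` at the additional
element. -/
def extend : (ModifiedLattice A)ᵒᵖ ⥤ AddCommGrpCat.{0} where
  obj x := extObj F x.unop
  map f := extMap F (leOfHom f.unop)
  map_id x := by
    obtain ⟨x | _⟩ := x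
    · exact F.map_id _
    · ext a; rfl
  map_comp {x y z} f g := by
    obtain ⟨x⟩ := x
    obtain ⟨y⟩ := y
    obtain ⟨z⟩ := z
    have hf := leOfHom f.unop
    have hg := leOfHom g.unop
    cases x with
    | cell x =>
      cases y with
      | cell y =>
        cases z with
        | cell z =>
          exact F.map_comp (homOfLE (show y ≤ x from hf)).op (homOfLE (show z ≤ y from hg)).op
        | extra => exact hg.elim
      | extra => exact hf.elim
    | extra =>
      cases y with
      | cell y =>
        cases z with
        | cell z => exact (zero_comp (C := AddCommGrpCat.{0})).symm
        | extra => exact hg.elim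
      | extra =>
        cases z with
        | cell z => exact (zero_comp (C := AddCommGrpCat.{0})).symm
        | extra => exact (zero_comp (C := AddCommGrpCat.{0})).symm

end ModifiedLattice

/-! ### Derived functors of the inverse limit -/

section HigherLimits

variable (C : Type) [SmallCategory C]

lemma presheafAB5 : AB5OfSize.{0, 0} (Cᵒᵖ ⥤ AddCommGrpCat.{0}) where
  ofShape _ _ _ := inferInstance

instance presheafEnoughInjectives : EnoughInjectives (Cᵒᵖ ⥤ AddCommGrpCat.{0}) :=
  haveI := presheafAB5 C
  haveI : HasSeparator AddCommGrpCat.{0} := IsGrothendieckAbelian.hasSeparator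
  haveI : IsGrothendieckAbelian.{0} (Cᵒᵖ ⥤ AddCommGrpCat.{0}) := { }
  inferInstance

instance limAdditive : (lim : (Cᵒᵖ ⥤ AddCommGrpCat.{0}) ⥤ AddCommGrpCat.{0}).Additive where
  map_add {F G f g} := by
    apply limit.hom_ext
    intro j
    simp [Preadditive.add_comp, Preadditive.comp_add]

variable {C}

/-- The value at the presheaf `F` of the `i`-th right derived functor of the inverse limit. -/
noncomputable def higherLimit (F : Cᵒᵖ ⥤ AddCommGrpCat.{0}) (i : ℕ) : AddCommGrpCat.{0} :=
  ((lim : (Cᵒᵖ ⥤ AddCommGrpCat.{0}) ⥤ AddCommGrpCat.{0}).rightDerived i).obj F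

end HigherLimits

/-! The maximal element `∅` of the Boolean lattice is initial in the opposite category, so limits
over the Boolean lattice alone are just evaluation there and have no higher derived functors. The
element `extra` is a second maximal element, above everything except `∅`. A compatible family on the
enlarged poset is a pair of values at `∅` and at `extra` whose restrictions to every singleton
agree. When the value at `extra` is zero, this is the kernel of the first differential of the cube.

To get all degrees, `cochainComplex` attaches to every presheaf `G` on the enlarged poset a complex
made of the values of `G` on the rows of the cube, with the value at `extra` added in degree `0`.
Three facts identify its cohomology with the higher limits. It is exact in `G`, because its terms
are products of values of `G` (`cochainComplex_shortExact`). Its cohomology in degree `0` is the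
limit (`limIsoHomologyZero`). It is acyclic in positive degrees on injective presheaves
(`cochainComplex_exactAt_of_injective`): an injective is a retract of a coinduced presheaf, whose
complex splits into augmented cochain complexes of simplices, and in positive degrees these are
contracted by coning off a vertex. By dimension shifting, any functor to complexes with these
properties computes the derived functors (`nonempty_rightDerived_iso_homology`).

For a presheaf extended by zero the added summand vanishes, and the complex is the signed cube
complex itself (`cochainComplexExtendIso`). The argument runs with whichever signs are given, so
different choices need not be compared. It uses nothing about links beyond the functoriality of the
Khovanov cube. -/

/-! ### Computing right derived functors by an exact functor to cochain complexes -/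

section DerivedByComplexes

universe v u v' u'

variable {𝒜 : Type u} [Category.{v} 𝒜] [Abelian 𝒜]

/-- The short exact sequence `0 ⟶ Zⁿ ⟶ Kⁿ ⟶ Zⁿ⁺¹ ⟶ 0` of a complex exact in degree `n + 1`. -/
noncomputable abbrev cyclesShortComplex (K : CochainComplex 𝒜 ℕ) (n : ℕ) : ShortComplex 𝒜 :=
  ShortComplex.mk (K.iCycles n) (K.toCycles n (n + 1)) (by
    rw [← cancel_mono (K.iCycles (n + 1))]; simp)

/-- The map to the next cycles has the same kernel as the differential, because the inclusion of
cycles is mono; its cokernel is the homology in degree `n + 1`, which vanishes. -/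
lemma cyclesShortComplex_shortExact (K : CochainComplex 𝒜 ℕ) (n : ℕ) (h : K.ExactAt (n + 1)) :
    (cyclesShortComplex K n).ShortExact where
  exact := ShortComplex.exact_of_f_is_kernel _
    (isKernelOfComp _ _ (K.cyclesIsKernel n (n + 1) (by simp)) _ (K.toCycles_i n (n + 1)))
  mono_f := by dsimp; infer_instance
  epi_g := by
    have h0 := h.isZero_homology
    have h1 := K.homologyIsCokernel n (n + 1) (by simp)
    exact Preadditive.epi_of_isZero_cokernel' _ h1 h0

variable {ℬ : Type u'} [Category.{v'} ℬ] [Abelian ℬ]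
  (C : 𝒜 ⥤ CochainComplex ℬ ℕ) [C.PreservesZeroMorphisms]

/-- Dimension shifting along the cycles of a complex with acyclic terms. -/
lemma nonempty_homology_cycles_iso (hC : ∀ S : ShortComplex 𝒜, S.ShortExact → (S.map C).ShortExact)
    (K : CochainComplex 𝒜 ℕ) (hK : ∀ n, K.ExactAt (n + 1))
    (hC' : ∀ k n, (C.obj (K.X k)).ExactAt (n + 1)) (j k : ℕ) :
    Nonempty ((C.obj (K.cycles k)).homology (j + 1) ≅ (C.obj (K.cycles (k + j))).homology 1) := by
  induction j generalizing k with
  | zero => exact ⟨Iso.refl _⟩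
  | succ j ih =>
    obtain ⟨e⟩ := ih (k + 1)
    have h := hC _ (cyclesShortComplex_shortExact K k (hK k))
    -- The middle complex is exact in degrees `j + 1` and `j + 2`, so the connecting map between the
    -- outer terms is invertible: the degree drops by one while the cycles move up by one.
    have e' := h.δIso (j + 1) (j + 2) (by simp) (hC' k j).isZero_homology
      (hC' k (j + 1)).isZero_homology
    rw [show k + 1 + j = k + (j + 1) by ring] at e
    exact ⟨e'.symm ≪≫ e⟩

variable (L : 𝒜 ⥤ ℬ) [PreservesFiniteLimits L]

/-- The positive degree homology of the image of a complex under a left exact functor `L` is the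
first homology of the objects of cycles, for any effaceable extension of `L`. -/
lemma nonempty_homology_map_iso [L.PreservesZeroMorphisms]
    (hC : ∀ S : ShortComplex 𝒜, S.ShortExact → (S.map C).ShortExact)
    (e : L ≅ C ⋙ HomologicalComplex.homologyFunctor ℬ _ 0)
    (K : CochainComplex 𝒜 ℕ) (n : ℕ) (hK : K.ExactAt (n + 1)) (hC' : (C.obj (K.X n)).ExactAt 1) :
    Nonempty (((L.mapHomologicalComplex _).obj K).homology (n + 1) ≅
      (C.obj (K.cycles n)).homology 1) := by
  have h := hC _ (cyclesShortComplex_shortExact K n hK)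
  -- The long exact sequence presents the first homology for the `n`-cycles as a cokernel of the map
  -- on degree zero homology; `δ` is epi because the middle complex is exact in degree `1`. The
  -- bundled statement retypes the degree zero terms as values of the composite functor, so that
  -- naturality of `e` applies to them.
  obtain ⟨δ, w, hδ, hepi⟩ : ∃ (δ : (C ⋙ HomologicalComplex.homologyFunctor ℬ _ 0).obj
      (K.cycles (n + 1)) ⟶ (C.obj (K.cycles n)).homology 1)
      (w : (C ⋙ HomologicalComplex.homologyFunctor ℬ _ 0).map (K.toCycles n (n + 1)) ≫ δ = 0),
      (ShortComplex.mk _ _ w).Exact ∧ Epi δ :=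
    ⟨h.δ 0 1 (by simp), h.comp_δ 0 1 (by simp), h.homology_exact₃ 0 1 (by simp),
      h.epi_δ 0 1 (by simp) hC'.isZero_homology⟩
  let T : ShortComplex ℬ := ShortComplex.mk (L.map (K.d n (n + 1))) (L.map (K.d (n + 1) (n + 2)))
    (by rw [← L.map_comp, K.d_comp_d, L.map_zero])
  have wi : L.map (K.iCycles (n + 1)) ≫ T.g = 0 := by
    rw [← L.map_comp, K.iCycles_d, L.map_zero]
  -- Left exactness of `L` is used here: it carries the object of cycles to the kernel of the next
  -- differential.
  have hi : IsLimit (KernelFork.ofι (L.map (K.iCycles (n + 1))) wi) :=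
    KernelFork.mapIsLimit _ (K.cyclesIsKernel (n + 1) (n + 2) (by simp)) L
  have hf : hi.lift (KernelFork.ofι T.f T.zero) = L.map (K.toCycles n (n + 1)) := by
    apply Fork.IsLimit.hom_ext hi
    rw [Fork.IsLimit.lift_ι]
    exact (L.congr_map (K.toCycles_i n (n + 1))).symm.trans (L.map_comp _ _)
  have hnat := e.hom.naturality (K.toCycles n (n + 1))
  let T' : ShortComplex ℬ := ShortComplex.mk (L.map (K.toCycles n (n + 1)))
    (e.hom.app _ ≫ δ) (by rw [← Category.assoc, hnat, Category.assoc, w, comp_zero])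
  have eT : T' ≅ ShortComplex.mk _ _ w := ShortComplex.isoMk
    (e.app _) (e.app _) (Iso.refl _) hnat.symm (by simp [T'])
  have hT' : T'.Exact := ShortComplex.exact_of_iso eT.symm hδ
  have : Epi T'.g := by dsimp [T']; infer_instance
  -- Homology is the cokernel of the lift of `T.f` to this kernel. By `hf` that lift is `L` applied
  -- to the map to cycles, whose cokernel is known through `e` and `δ`.
  let D : T.LeftHomologyData :=
    { K := L.obj (K.cycles (n + 1))
      H := (C.obj (K.cycles n)).homology 1
      i := L.map (K.iCycles (n + 1))
      π := T'.g
      wi := wi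
      hi := hi
      wπ := by rw [hf]; exact T'.zero
      hπ := by
        -- Generalising over `f` allows the equation `hf` to be substituted, although the vanishing
        -- proof `w` depends on `f`.
        have key : ∀ (f : T.X₁ ⟶ L.obj (K.cycles (n + 1))) (w : f ≫ T'.g = 0), f = T'.f →
            Nonempty (IsColimit (CokernelCofork.ofπ T'.g w)) := by
          rintro f w rfl
          exact ⟨hT'.gIsCokernel⟩
        exact (key _ _ hf).some }
  exact ⟨ShortComplex.homologyMapIso (((L.mapHomologicalComplex _).obj K).isoSc' n (n + 1) (n + 2)
    (by simp) (by simp)) ≪≫ D.homologyIso⟩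

/-- An exact functor to cochain complexes whose homology in degree `0` is `L` and that sends
injective objects to complexes that are exact in positive degrees computes the right derived
functors of `L`. -/
theorem nonempty_rightDerived_iso_homology [EnoughInjectives 𝒜] [L.Additive]
    (hC : ∀ S : ShortComplex 𝒜, S.ShortExact → (S.map C).ShortExact)
    (hC' : ∀ (J : 𝒜) [Injective J] (n : ℕ), (C.obj J).ExactAt (n + 1))
    (e : L ≅ C ⋙ HomologicalComplex.homologyFunctor ℬ _ 0) (X : 𝒜) (n : ℕ) :
    Nonempty ((L.rightDerived n).obj X ≅ (C.obj X).homology n) := by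
  obtain _ | n := n
  · exact ⟨L.rightDerivedZeroIsoSelf.app X ≪≫ e.app X⟩
  let I := injectiveResolution X
  obtain ⟨e₁⟩ := nonempty_homology_map_iso C L hC e I.cocomplex n (I.cocomplex_exactAt_succ n)
    (hC' _ 0)
  obtain ⟨e₂⟩ := nonempty_homology_cycles_iso C hC I.cocomplex I.cocomplex_exactAt_succ
    (fun k n => hC' _ n) n 0
  rw [zero_add] at e₂
  -- The resolved object is the kernel of the first differential of its resolution, which closes the
  -- chain from the derived functor of `X` back to the complex of `X`.
  let e₃ : X ≅ I.cocomplex.cycles 0 :=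
    I.isLimitKernelFork.conePointUniqueUpToIso (I.cocomplex.cyclesIsKernel 0 1 (by simp))
  exact ⟨I.isoRightDerivedObj L (n + 1) ≪≫ e₁ ≪≫ e₂.symm ≪≫
    (C ⋙ HomologicalComplex.homologyFunctor ℬ _ (n + 1)).mapIso e₃.symm⟩

/-! ### Degree zero homology as a natural kernel. -/

/-- Both `A` and the cycles are kernels of the same differential, and the lift is the comparison of
the two kernels. -/
lemma isIso_liftCycles_of_exact {K : CochainComplex ℬ ℕ} {A : ℬ} (f : A ⟶ K.X 0) [Mono f]
    (w : f ≫ K.d 0 1 = 0) (h : (ShortComplex.mk _ _ w).Exact) :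
    IsIso (K.liftCycles f 1 (by simp) w) := by
  have : K.liftCycles f 1 (by simp) w =
      (IsLimit.conePointUniqueUpToIso h.fIsKernel (K.cyclesIsKernel 0 1 (by simp))).hom := by
    rw [← cancel_mono (K.iCycles 0), K.liftCycles_i]
    exact (IsLimit.conePointUniqueUpToIso_hom_comp h.fIsKernel (K.cyclesIsKernel 0 1 (by simp))
      WalkingParallelPair.zero).symm
  rw [this]
  infer_instance

/-- A natural kernel of the differential in degree `0` is the homology in degree `0`. -/
noncomputable def isoHomologyZeroOfExact (L : 𝒜 ⥤ ℬ) (C : 𝒜 ⥤ CochainComplex ℬ ℕ)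
    (ι : ∀ X, L.obj X ⟶ (C.obj X).X 0)
    (hι : ∀ {X Y : 𝒜} (f : X ⟶ Y), L.map f ≫ ι Y = ι X ≫ (C.map f).f 0)
    (w : ∀ X, ι X ≫ (C.obj X).d 0 1 = 0)
    (h : ∀ X, Mono (ι X)) (h' : ∀ X, (ShortComplex.mk _ _ (w X)).Exact) :
    L ≅ C ⋙ HomologicalComplex.homologyFunctor ℬ _ 0 :=
  NatIso.ofComponents (fun X => @asIso _ _ _ _ _ (isIso_liftCycles_of_exact (ι X) (w X) (h' X)) ≪≫
    (C.obj X).isoHomologyπ₀) (by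
    intro X Y f
    have key : L.map f ≫ (C.obj Y).liftCycles (ι Y) 1 (by simp) (w Y) ≫ (C.obj Y).homologyπ 0 =
        ((C.obj X).liftCycles (ι X) 1 (by simp) (w X) ≫ (C.obj X).homologyπ 0) ≫
          HomologicalComplex.homologyMap (C.map f) 0 := by
      rw [Category.assoc, HomologicalComplex.homologyπ_naturality, ← Category.assoc,
        ← Category.assoc]
      congr 1
      rw [← cancel_mono ((C.obj Y).iCycles 0)]
      simp [hι]
    exact key)

end DerivedByComplexes

/-! ### Cochains of a cube -/

section CubeCochains

variable {A : Type}

/-- The map that a morphism of presheaves induces on `n`-cochains. -/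
def cubeCochainMap {F F' : (BooleanLattice A)ᵒᵖ ⥤ AddCommGrpCat.{0}} (η : F ⟶ F') (n : ℕ) :
    CubeCochain F n →+ CubeCochain F' n where
  toFun a x := (η.app (Opposite.op (BooleanLattice.of x.1))).hom (a x)
  map_zero' := by funext x; simp
  map_add' a b := by funext x; simp

lemma cubeCochainMap_apply {F F' : (BooleanLattice A)ᵒᵖ ⥤ AddCommGrpCat.{0}} (η : F ⟶ F') (n : ℕ)
    (a : CubeCochain F n) (x : Row A n) :
    cubeCochainMap η n a x = (η.app (Opposite.op (BooleanLattice.of x.1))).hom (a x) := rfl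

lemma cubeCochainMap_id (F : (BooleanLattice A)ᵒᵖ ⥤ AddCommGrpCat.{0}) (n : ℕ)
    (a : CubeCochain F n) : cubeCochainMap (𝟙 F) n a = a := rfl

lemma cubeCochainMap_comp {F F' F'' : (BooleanLattice A)ᵒᵖ ⥤ AddCommGrpCat.{0}} (η : F ⟶ F')
    (θ : F' ⟶ F'') (n : ℕ) (a : CubeCochain F n) :
    cubeCochainMap (η ≫ θ) n a = cubeCochainMap θ n (cubeCochainMap η n a) := rfl

lemma cubeHom_naturality {F F' : (BooleanLattice A)ᵒᵖ ⥤ AddCommGrpCat.{0}} (η : F ⟶ F')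
    {y x : Finset A} (h : y ⊆ x) (a : cubeObj F y) :
    (η.app (Opposite.op (BooleanLattice.of x))).hom (cubeHom F h a) =
      cubeHom F' h ((η.app (Opposite.op (BooleanLattice.of y))).hom a) :=
  ConcreteCategory.congr_hom (η.naturality (BooleanLattice.homOf h).op) a

variable [DecidableEq A] (ε : CubeSigns A)

lemma cubeD_apply (F : (BooleanLattice A)ᵒᵖ ⥤ AddCommGrpCat.{0}) (n : ℕ) (a : CubeCochain F n)
    (x : Row A (n + 1)) : cubeD F ε n a x =
      ∑ c : x.1, ε.sign (x.erase c).1 c.1 • cubeHom F (x.erase_subset c) (a (x.erase c)) := rfl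

lemma map_units_smul {M N : Type*} [AddCommGroup M] [AddCommGroup N] (f : M →+ N) (u : ℤˣ)
    (m : M) : f (u • m) = u • f m := by
  simp only [Units.smul_def]
  exact map_zsmul _ _ _

lemma cubeD_naturality {F F' : (BooleanLattice A)ᵒᵖ ⥤ AddCommGrpCat.{0}} (η : F ⟶ F') (n : ℕ)
    (a : CubeCochain F n) :
    cubeCochainMap η (n + 1) (cubeD F ε n a) = cubeD F' ε n (cubeCochainMap η n a) := by
  funext x
  rw [cubeCochainMap_apply, cubeD_apply, cubeD_apply, map_sum]
  refine Finset.sum_congr rfl fun c _ => ?_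
  rw [map_units_smul, cubeHom_naturality, cubeCochainMap_apply]

/-- A contracting homotopy for cochains on the simplex spanned by the neighbours of `c`. -/
lemma CubeSigns.sum_homotopy {M : Type*} [AddCommGroup M] (α : Finset A → M) (c : A) (x : Finset A)
    (h : c ∉ x → ∑ d ∈ insert c x, ε.sign ((insert c x).erase d) d • α ((insert c x).erase d) = 0) :
    ∑ d ∈ x, ε.sign (x.erase d) d •
      (if c ∈ x.erase d then 0 else ε.sign (x.erase d) c • α (insert c (x.erase d))) = α x := by
  -- If `c ∈ x`, erasing any `d ≠ c` leaves `c` in the set, so only `d = c` contributes and its sign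
  -- is squared. If `c ∉ x`, the cocycle condition on `insert c x` expresses `α x` through the
  -- remaining faces.
  by_cases hc : c ∈ x
  · rw [Finset.sum_eq_single_of_mem c hc]
    · rw [if_neg (Finset.notMem_erase _ _), Finset.insert_erase hc, smul_smul, Int.units_mul_self,
        one_smul]
    · intro d _ hdc
      rw [if_pos (Finset.mem_erase.2 ⟨hdc.symm, hc⟩), smul_zero]
  · have h := h hc
    rw [Finset.sum_insert hc, Finset.erase_insert hc] at h
    have h2 : ∀ d ∈ x, ε.sign (x.erase d) d •
        (if c ∈ x.erase d then 0 else ε.sign (x.erase d) c • α (insert c (x.erase d))) =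
        -ε.sign x c • (ε.sign ((insert c x).erase d) d • α ((insert c x).erase d)) := by
      intro d hd
      have hcd : c ≠ d := fun e => hc (e ▸ hd)
      -- The square spanned by `c` and `d` over `x.erase d` provides the minus sign relating the two
      -- ways of reaching `insert c x`.
      have hs := ε.square (x.erase d) d c (by simp) (by simp [hc]) hcd.symm
      rw [if_neg (by simp [hc]), Finset.erase_insert_of_ne hcd, smul_smul, smul_smul]
      rw [Finset.insert_erase hd] at hs
      congr 1
      revert hs
      generalize ε.sign (x.erase d) d = p
      generalize ε.sign x c = q
      generalize ε.sign (x.erase d) c = r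
      generalize ε.sign (insert c (x.erase d)) d = s
      revert p q r s
      decide
    rw [Finset.sum_congr rfl h2, ← Finset.smul_sum, ← neg_eq_of_add_eq_zero_right h, smul_neg,
      Units.neg_smul, neg_neg, smul_smul, Int.units_mul_self, one_smul]

end CubeCochains

/-! ### The cochain complex of a presheaf on the modified Boolean lattice -/

namespace ModifiedLattice

variable {A : Type}

/-- The inclusion of the Boolean lattice. -/
def cellFunctor (A : Type) : BooleanLattice A ⥤ ModifiedLattice A :=
  Monotone.functor (f := cell) fun _ _ h => h

/-- The inclusion of the additional element, as a constant functor. -/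
def extraFunctor (A : Type) : BooleanLattice A ⥤ ModifiedLattice A :=
  (Functor.const _).obj extra

lemma cell_le_extra {x : Finset A} (hx : x ≠ ∅) : cell (BooleanLattice.of x) ≤ extra := hx

variable (G : (ModifiedLattice A)ᵒᵖ ⥤ AddCommGrpCat.{0})

/-- The restriction of a presheaf to the Boolean lattice. -/
abbrev onCells : (BooleanLattice A)ᵒᵖ ⥤ AddCommGrpCat.{0} := (cellFunctor A).op ⋙ G

/-- The constant presheaf on the Boolean lattice with the value at the additional element. -/
abbrev onExtra : (BooleanLattice A)ᵒᵖ ⥤ AddCommGrpCat.{0} := (extraFunctor A).op ⋙ G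

/-- Restriction from the additional element to a nonempty set. -/
def extraHom {x : Finset A} (hx : x ≠ ∅) : cubeObj (onExtra G) x →+ cubeObj (onCells G) x :=
  (G.map (homOfLE (cell_le_extra hx)).op).hom

/-- Both sides come from the same relation between `cell x` and `extra`, factored in two ways; in a
poset the two composites are the same arrow. -/
lemma cubeHom_extraHom {y x : Finset A} (h : y ⊆ x) (hy : y ≠ ∅) (hx : x ≠ ∅)
    (b : cubeObj (onExtra G) y) :
    cubeHom (onCells G) h (extraHom G hy b) = extraHom G hx (cubeHom (onExtra G) h b) := by
  let p := (homOfLE (cell_le_extra hy)).op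
  let q := ((cellFunctor A).map (BooleanLattice.homOf h)).op
  let p' := ((extraFunctor A).map (BooleanLattice.homOf h)).op
  let q' := (homOfLE (cell_le_extra hx)).op
  have e : G.map p ≫ G.map q = G.map p' ≫ G.map q' :=
    (G.map_comp p q).symm.trans (G.map_comp p' q')
  exact ConcreteCategory.congr_hom e b

lemma _root_.Row.ne_empty {n : ℕ} (x : Row A (n + 1)) : x.1 ≠ ∅ := by
  intro h
  have := x.2
  simp [h] at this

/-- Restriction of cochains of positive degree from the additional element to the cells. -/
def extraCochain (n : ℕ) : CubeCochain (onExtra G) (n + 1) →+ CubeCochain (onCells G) (n + 1) where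
  toFun b x := extraHom G (Row.ne_empty x) (b x)
  map_zero' := by funext x; simp
  map_add' a b := by funext x; simp

lemma extraCochain_naturality {G G' : (ModifiedLattice A)ᵒᵖ ⥤ AddCommGrpCat.{0}} (η : G ⟶ G')
    (n : ℕ) (b : CubeCochain (onExtra G) (n + 1)) :
    cubeCochainMap (Functor.whiskerLeft _ η) (n + 1) (extraCochain G n b) =
      extraCochain G' n (cubeCochainMap (Functor.whiskerLeft _ η) (n + 1) b) := by
  funext x
  exact ConcreteCategory.congr_hom (η.naturality (homOfLE (cell_le_extra (Row.ne_empty x))).op)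
    (b x)

variable [DecidableEq A] (ε : CubeSigns A)

/-- In positive degrees all faces involved are nonempty, so restriction from `extra` is defined on
them and commutes with the differentials. This makes the added summand in degree `0` compatible with
the differential squaring to zero. -/
lemma cubeD_extraCochain (n : ℕ) (b : CubeCochain (onExtra G) (n + 1)) :
    cubeD (onCells G) ε (n + 1) (extraCochain G n b) =
      extraCochain G (n + 1) (cubeD (onExtra G) ε (n + 1) b) := by
  funext x
  change _ = extraHom G (Row.ne_empty x) _
  rw [cubeD_apply, cubeD_apply, map_sum]
  refine Finset.sum_congr rfl fun c _ => ?_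
  rw [map_units_smul, ← cubeHom_extraHom G (x.erase_subset c) (Row.ne_empty _)]
  rfl

/-- The `n`-cochains: in degree `0` the additional element contributes a second copy of the
maximal element. -/
def cochain (n : ℕ) : AddCommGrpCat.{0} :=
  match n with
  | 0 => AddCommGrpCat.of (CubeCochain (onCells G) 0 × CubeCochain (onExtra G) 0)
  | n + 1 => AddCommGrpCat.of (CubeCochain (onCells G) (n + 1))

/-- The differential: in degree `0`, the difference of the contributions of both elements. -/
def cochainD (n : ℕ) : cochain G n ⟶ cochain G (n + 1) :=
  match n with
  | 0 => AddCommGrpCat.ofHom ((cubeD (onCells G) ε 0).comp (AddMonoidHom.fst _ _) -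
      ((extraCochain G 0).comp (cubeD (onExtra G) ε 0)).comp (AddMonoidHom.snd _ _))
  | n + 1 => AddCommGrpCat.ofHom (cubeD (onCells G) ε (n + 1))

lemma cochainD_zero_apply (a : CubeCochain (onCells G) 0) (b : CubeCochain (onExtra G) 0) :
    (cochainD G ε 0).hom (a, b) =
      cubeD (onCells G) ε 0 a - extraCochain G 0 (cubeD (onExtra G) ε 0 b) := rfl

lemma cochainD_succ_apply (n : ℕ) (a : CubeCochain (onCells G) (n + 1)) :
    (cochainD G ε (n + 1)).hom a = cubeD (onCells G) ε (n + 1) a := rfl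

lemma cochainD_comp (n : ℕ) : cochainD G ε n ≫ cochainD G ε (n + 1) = 0 := by
  ext a
  change (cochainD G ε (n + 1)).hom ((cochainD G ε n).hom a) = 0
  cases n with
  | zero =>
    obtain ⟨a, b⟩ := a
    rw [cochainD_zero_apply, cochainD_succ_apply, map_sub, cubeD_comp, cubeD_extraCochain,
      cubeD_comp, map_zero, sub_zero]
    rfl
  | succ n => exact cubeD_comp _ _ _ _

/-- The map on cochains that is induced by a morphism of presheaves. -/
def cochainMap {G G' : (ModifiedLattice A)ᵒᵖ ⥤ AddCommGrpCat.{0}} (η : G ⟶ G') (n : ℕ) :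
    cochain G n ⟶ cochain G' n :=
  match n with
  | 0 => AddCommGrpCat.ofHom ((cubeCochainMap (Functor.whiskerLeft _ η) 0).prodMap
      (cubeCochainMap (Functor.whiskerLeft _ η) 0))
  | n + 1 => AddCommGrpCat.ofHom (cubeCochainMap (Functor.whiskerLeft _ η) (n + 1))

lemma cochainMap_comm {G G' : (ModifiedLattice A)ᵒᵖ ⥤ AddCommGrpCat.{0}} (η : G ⟶ G') (n : ℕ) :
    cochainMap η n ≫ cochainD G' ε n = cochainD G ε n ≫ cochainMap η (n + 1) := by
  ext a
  cases n with
  | zero =>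
    obtain ⟨a, b⟩ := a
    change cubeD _ ε 0 _ - extraCochain G' 0 (cubeD _ ε 0 _) =
      cubeCochainMap (Functor.whiskerLeft _ η) 1
        (cubeD (onCells G) ε 0 a - extraCochain G 0 (cubeD (onExtra G) ε 0 b))
    rw [map_sub, cubeD_naturality, extraCochain_naturality, cubeD_naturality]
    rfl
  | succ n => exact (cubeD_naturality ε _ _ _).symm

/-- The cochain complex of the modified Boolean lattice, as a functor of the presheaf. -/
noncomputable def cochainComplex :
    ((ModifiedLattice A)ᵒᵖ ⥤ AddCommGrpCat.{0}) ⥤ CochainComplex AddCommGrpCat.{0} ℕ where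
  obj G := CochainComplex.of (cochain G) (cochainD G ε) (cochainD_comp G ε)
  map η := CochainComplex.ofHom (fun n => cochainMap η n) fun n => by
    dsimp only [CochainComplex.of]
    rw [CochainComplex.of_d, CochainComplex.of_d]
    exact cochainMap_comm ε η n
  map_id G := by
    ext n
    cases n <;> rfl
  map_comp η θ := by
    ext n
    cases n <;> rfl

lemma cochainComplex_d (n : ℕ) : ((cochainComplex ε).obj G).d n (n + 1) = cochainD G ε n :=
  CochainComplex.of_d _ _ _

instance : (cochainComplex (A := A) ε).PreservesZeroMorphisms where
  map_zero G G' := by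
    ext n
    cases n <;> rfl

end ModifiedLattice

/-! ### Exactness of the cochain complex in the presheaf -/

namespace ModifiedLattice

variable {A : Type}

lemma cubeCochainMap_injective {F F' : (BooleanLattice A)ᵒᵖ ⥤ AddCommGrpCat.{0}} (η : F ⟶ F')
    (h : ∀ x, Function.Injective (η.app x).hom) (n : ℕ) :
    Function.Injective (cubeCochainMap η n) := fun _ _ e =>
  funext fun x => h _ (congrFun e x)

lemma cubeCochainMap_surjective {F F' : (BooleanLattice A)ᵒᵖ ⥤ AddCommGrpCat.{0}} (η : F ⟶ F')
    (h : ∀ x, Function.Surjective (η.app x).hom) (n : ℕ) :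
    Function.Surjective (cubeCochainMap η n) := fun b => by
  choose a ha using fun x : Row A n => h _ (b x)
  exact ⟨a, funext ha⟩

lemma cubeCochainMap_exact {F F' F'' : (BooleanLattice A)ᵒᵖ ⥤ AddCommGrpCat.{0}} (η : F ⟶ F')
    (θ : F' ⟶ F'') (h : ∀ x (b : F'.obj x), (θ.app x).hom b = 0 → ∃ a, (η.app x).hom a = b) (n : ℕ)
    (b : CubeCochain F' n) (hb : cubeCochainMap θ n b = 0) : ∃ a, cubeCochainMap η n a = b := by
  choose a ha using fun x : Row A n => h _ (b x) (congrFun hb x)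
  exact ⟨a, funext ha⟩

variable {S : ShortComplex ((ModifiedLattice A)ᵒᵖ ⥤ AddCommGrpCat.{0})}

/-- Evaluation at an object is exact, so short exactness of presheaves may be tested on values; the
same holds for the next two lemmas. -/
lemma injective_app_of_shortExact (hS : S.ShortExact) (x : (ModifiedLattice A)ᵒᵖ) :
    Function.Injective (S.f.app x).hom :=
  (AddCommGrpCat.mono_iff_injective _).1
    (hS.map_of_exact ((evaluation _ AddCommGrpCat.{0}).obj x)).mono_f

lemma surjective_app_of_shortExact (hS : S.ShortExact) (x : (ModifiedLattice A)ᵒᵖ) :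
    Function.Surjective (S.g.app x).hom :=
  (AddCommGrpCat.epi_iff_surjective _).1
    (hS.map_of_exact ((evaluation _ AddCommGrpCat.{0}).obj x)).epi_g

lemma exact_app_of_shortExact (hS : S.ShortExact) (x : (ModifiedLattice A)ᵒᵖ) (b : S.X₂.obj x)
    (hb : (S.g.app x).hom b = 0) : ∃ a, (S.f.app x).hom a = b :=
  (ShortComplex.ab_exact_iff _).1
    (hS.map_of_exact ((evaluation _ AddCommGrpCat.{0}).obj x)).exact b hb

lemma cochainMap_injective (hS : S.ShortExact) (n : ℕ) :
    Function.Injective (cochainMap S.f n).hom := by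
  have h : ∀ (σ : BooleanLattice A ⥤ ModifiedLattice A) n,
      Function.Injective (cubeCochainMap (Functor.whiskerLeft σ.op S.f) n) := fun σ =>
    cubeCochainMap_injective _ fun x => injective_app_of_shortExact hS _
  cases n with
  | zero => exact (h _ 0).prodMap (h _ 0)
  | succ n => exact h _ _

lemma cochainMap_surjective (hS : S.ShortExact) (n : ℕ) :
    Function.Surjective (cochainMap S.g n).hom := by
  have h : ∀ (σ : BooleanLattice A ⥤ ModifiedLattice A) n,
      Function.Surjective (cubeCochainMap (Functor.whiskerLeft σ.op S.g) n) := fun σ =>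
    cubeCochainMap_surjective _ fun x => surjective_app_of_shortExact hS _
  cases n with
  | zero => exact (h _ 0).prodMap (h _ 0)
  | succ n => exact h _ _

lemma cochainMap_exact (hS : S.ShortExact) (n : ℕ) (b : cochain S.X₂ n)
    (hb : (cochainMap S.g n).hom b = 0) : ∃ a, (cochainMap S.f n).hom a = b := by
  have h : ∀ (σ : BooleanLattice A ⥤ ModifiedLattice A) n b,
      cubeCochainMap (Functor.whiskerLeft σ.op S.g) n b = 0 →
      ∃ a, cubeCochainMap (Functor.whiskerLeft σ.op S.f) n a = b := fun σ =>
    cubeCochainMap_exact _ _ fun x => exact_app_of_shortExact hS _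
  cases n with
  | zero =>
    obtain ⟨b, b'⟩ := b
    obtain ⟨a, ha⟩ := h _ 0 b (congrArg Prod.fst hb)
    obtain ⟨a', ha'⟩ := h _ 0 b' (congrArg Prod.snd hb)
    exact ⟨(a, a'), Prod.ext ha ha'⟩
  | succ n => exact h _ _ b hb

/-- In each degree the cochains are a product of values of the presheaf, and products of abelian
groups are exact. -/
lemma cochainComplex_shortExact [DecidableEq A] (ε : CubeSigns A) (hS : S.ShortExact) :
    (S.map (cochainComplex ε)).ShortExact := by
  refine HomologicalComplex.shortExact_of_degreewise_shortExact _ fun n => ?_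
  exact
    { exact := (ShortComplex.ab_exact_iff _).2 (cochainMap_exact hS n)
      mono_f := (AddCommGrpCat.mono_iff_injective _).2 (cochainMap_injective hS n)
      epi_g := (AddCommGrpCat.epi_iff_surjective _).2 (cochainMap_surjective hS n) }

/-! ### The inverse limit as cohomology in degree zero -/

/-- The unique member of row `0`. -/
def _root_.Row.empty (A : Type) : Row A 0 := ⟨∅, rfl⟩

lemma _root_.Row.eq_empty (x : Row A 0) : x = Row.empty A :=
  Subtype.ext (Finset.card_eq_zero.1 x.2)

/-- A compatible family consists of `0`-cochains. -/
noncomputable def limToCochain (G : (ModifiedLattice A)ᵒᵖ ⥤ AddCommGrpCat.{0}) :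
    lim.obj G ⟶ cochain G 0 :=
  AddCommGrpCat.ofHom (AddMonoidHom.prod
    (AddMonoidHom.mk' (fun v x => (limit.π G (Opposite.op (cell (BooleanLattice.of x.1)))).hom v)
      (fun _ _ => funext fun _ => map_add _ _ _))
    (AddMonoidHom.mk' (fun v _ => (limit.π G (Opposite.op extra)).hom v)
      (fun _ _ => funext fun _ => map_add _ _ _)))

lemma limToCochain_naturality {G G' : (ModifiedLattice A)ᵒᵖ ⥤ AddCommGrpCat.{0}} (η : G ⟶ G') :
    lim.map η ≫ limToCochain G' = limToCochain G ≫ cochainMap η 0 := by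
  ext v
  refine Prod.ext (funext fun x => ?_) (funext fun x => ?_)
  · exact ConcreteCategory.congr_hom (limMap_π η (Opposite.op (cell (BooleanLattice.of x.1)))) v
  · exact ConcreteCategory.congr_hom (limMap_π η (Opposite.op extra)) v

variable (G : (ModifiedLattice A)ᵒᵖ ⥤ AddCommGrpCat.{0})

lemma map_lim_π {x y : ModifiedLattice A} (h : x ≤ y) (v : (limit G : AddCommGrpCat.{0})) :
    (G.map (homOfLE h).op).hom ((limit.π G (Opposite.op y)).hom v) =
      (limit.π G (Opposite.op x)).hom v :=
  ConcreteCategory.congr_hom (limit.w G (homOfLE h).op) v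

lemma exists_lim_of_compatible (s : ∀ z, G.obj (Opposite.op z))
    (hs : ∀ {x y : ModifiedLattice A} (h : x ≤ y), (G.map (homOfLE h).op).hom (s y) = s x) :
    ∃ v : (limit G : AddCommGrpCat.{0}), ∀ z, (limit.π G (Opposite.op z)).hom v = s z := by
  -- Elements of an abelian group are homomorphisms from `ℤ`, so a compatible family is a cone with
  -- apex `ℤ`; the image of `1` under the induced map is the wanted element.
  let c : Cone G :=
    { pt := AddCommGrpCat.of ℤ
      π :=
        { app := fun j => AddCommGrpCat.ofHom (zmultiplesHom _ (s j.unop))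
          naturality := fun x y f => by
            refine AddCommGrpCat.hom_ext (AddMonoidHom.ext fun k : ℤ => ?_)
            change k • s y.unop = (G.map f).hom (k • s x.unop)
            rw [map_zsmul]
            exact congrArg _ (hs (leOfHom f.unop)).symm } }
  refine ⟨(limit.lift G c).hom (1 : ℤ), fun z => ?_⟩
  refine (ConcreteCategory.congr_hom (limit.lift_π c (Opposite.op z)) (1 : ℤ)).trans ?_
  exact one_zsmul _

lemma cubeHom_onExtra {y x : Finset A} (h : y ⊆ x) (b : cubeObj (onExtra G) y) :
    cubeHom (onExtra G) h b = b :=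
  ConcreteCategory.congr_hom (G.map_id (Opposite.op extra)) b

lemma cell_le_cell_empty (x : BooleanLattice A) : cell x ≤ cell (BooleanLattice.of ∅) :=
  Finset.empty_subset x.toFinset

/-- Every cell lies below `∅`, so a compatible family is determined by its values at the two maximal
elements. -/
lemma limToCochain_injective : Function.Injective (limToCochain G).hom := by
  intro v w h
  have h1 := congrFun (congrArg Prod.fst h) (Row.empty A)
  have h2 := congrFun (congrArg Prod.snd h) (Row.empty A)
  refine Concrete.limit_ext G v w fun j => ?_
  obtain ⟨x | _⟩ := j
  · have := congrArg (G.map (homOfLE (cell_le_cell_empty x)).op).hom h1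
    exact (map_lim_π G (cell_le_cell_empty x) v).symm.trans
      (this.trans (map_lim_π G (cell_le_cell_empty x) w))
  · exact h2

/-! ### Acyclicity of injective presheaves -/

/-- The presheaf coinduced from a family of abelian groups. -/
def coinduced (M : ModifiedLattice A → AddCommGrpCat.{0}) :
    (ModifiedLattice A)ᵒᵖ ⥤ AddCommGrpCat.{0} where
  obj x := AddCommGrpCat.of (∀ z : {z // z ≤ x.unop}, M z.1)
  map f := AddCommGrpCat.ofHom
    { toFun := fun a z => a ⟨z.1, z.2.trans (leOfHom f.unop)⟩
      map_zero' := rfl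
      map_add' := fun _ _ => rfl }

/-- The embedding of a presheaf into the presheaf coinduced from its values. -/
def toCoinduced (G : (ModifiedLattice A)ᵒᵖ ⥤ AddCommGrpCat.{0}) :
    G ⟶ coinduced fun z => G.obj (Opposite.op z) where
  app x := AddCommGrpCat.ofHom
    { toFun := fun a z => (G.map (homOfLE z.2).op).hom a
      map_zero' := by funext z; simp
      map_add' := fun _ _ => by funext z; simp }
  naturality x y f := by
    ext a
    funext z
    exact (ConcreteCategory.congr_hom (G.map_comp f (homOfLE z.2).op) a).symm

/-- The component at `x` itself recovers the element, since restriction along the identity is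
trivial. -/
instance (G : (ModifiedLattice A)ᵒᵖ ⥤ AddCommGrpCat.{0}) : Mono (toCoinduced G) := by
  have : ∀ x, Mono ((toCoinduced G).app x) := fun x => by
    rw [AddCommGrpCat.mono_iff_injective]
    intro a b h
    have h := congrFun h ⟨x.unop, le_refl _⟩
    have e : ∀ c : G.obj x, (G.map (homOfLE (le_refl x.unop)).op).hom c = c := fun c =>
      ConcreteCategory.congr_hom (G.map_id x) c
    exact (e a).symm.trans (h.trans (e b))
  exact NatTrans.mono_of_mono_app _

/-- The component of an element of a coinduced presheaf at an element below. -/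
def coinducedEval {M : ModifiedLattice A → AddCommGrpCat.{0}} {x : Finset A} {z : ModifiedLattice A}
    (h : z ≤ cell (BooleanLattice.of x)) : cubeObj (onCells (coinduced M)) x →+ M z :=
  Pi.evalAddMonoidHom (fun z : {z // z ≤ cell (BooleanLattice.of x)} => M z.1) ⟨z, h⟩

lemma coinducedEval_ext {M : ModifiedLattice A → AddCommGrpCat.{0}} {x : Finset A}
    {u v : cubeObj (onCells (coinduced M)) x}
    (h : ∀ (z : ModifiedLattice A) (hz : z ≤ cell (BooleanLattice.of x)),
      coinducedEval hz u = coinducedEval hz v) : u = v :=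
  funext fun z => h z.1 z.2

/-- A cochain with values in a coinduced presheaf, at a fixed element below. -/
noncomputable def coinducedCochainAt {M : ModifiedLattice A → AddCommGrpCat.{0}} {n : ℕ}
    (a : CubeCochain (onCells (coinduced M)) n) (z : ModifiedLattice A) (x : Finset A) : M z :=
  open Classical in
  -- Extending by `0` gives a function on all finite sets, the form that `CubeSigns.sum_homotopy`
  -- requires; the homotopy argument only relies on values where the condition holds.
  if h : x.card = n ∧ z ≤ cell (BooleanLattice.of x) then coinducedEval h.2 (a ⟨x, h.1⟩) else 0

lemma coinducedCochainAt_eq {M : ModifiedLattice A → AddCommGrpCat.{0}} {n : ℕ}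
    (a : CubeCochain (onCells (coinduced M)) n) (x : Row A n) {z : ModifiedLattice A}
    (hz : z ≤ cell (BooleanLattice.of x.1)) :
    coinducedCochainAt a z x.1 = coinducedEval hz (a x) :=
  dif_pos ⟨x.2, hz⟩

variable [DecidableEq A] (ε : CubeSigns A)

/-- Erasing elements moves up in the order, so a `z` below `x` is below all its faces. Hence the
differential can be computed one `z` at a time, with constant coefficients `M z`. -/
lemma coinducedEval_cubeD {M : ModifiedLattice A → AddCommGrpCat.{0}} {n : ℕ}
    (a : CubeCochain (onCells (coinduced M)) n) (x : Row A (n + 1)) {z : ModifiedLattice A}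
    (hz : z ≤ cell (BooleanLattice.of x.1)) :
    coinducedEval hz (cubeD _ ε n a x) =
      ∑ d ∈ x.1, ε.sign (x.1.erase d) d • coinducedCochainAt a z (x.1.erase d) := by
  rw [cubeD_apply, map_sum, ← Finset.sum_coe_sort x.1 (fun d => ε.sign (x.1.erase d) d •
    coinducedCochainAt a z (x.1.erase d))]
  refine Finset.sum_congr rfl fun c _ => ?_
  have hc : z ≤ cell (BooleanLattice.of (x.erase c).1) :=
    hz.trans (show cell _ ≤ cell _ from x.erase_subset c)
  rw [map_units_smul]
  exact congrArg _ (coinducedCochainAt_eq a (x.erase c) hc).symm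

/-- For fixed `z = cell t`, the cochains live on the subsets of `t`: they form the augmented cochain
complex of the simplex with vertex set `t`. For nonempty `t` a chosen vertex gives a contraction. -/
lemma exists_cubeD_eq_coinduced {M : ModifiedLattice A → AddCommGrpCat.{0}} {n : ℕ}
    (a : CubeCochain (onCells (coinduced M)) (n + 1)) (ha : cubeD _ ε (n + 1) a = 0) :
    ∃ b, cubeD _ ε n b = a := by
  classical
  -- The cone vertex is `ht.choose`, chosen for each `t` separately and independent of `x`. The
  -- value `0` for empty `t` is harmless: the equation is checked at nonempty `x ⊆ t`. The component
  -- at `extra` does not occur below a cell.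
  let b : CubeCochain (onCells (coinduced M)) n := fun x z =>
    match z with
    | ⟨extra, _⟩ => 0
    | ⟨cell t, _⟩ =>
      if ht : t.toFinset.Nonempty then
        if ht.choose ∈ x.1 then 0 else
          ε.sign x.1 ht.choose • coinducedCochainAt a (cell t) (insert ht.choose x.1)
      else 0
  refine ⟨b, funext fun x => coinducedEval_ext fun z hz => ?_⟩
  rw [coinducedEval_cubeD, ← coinducedCochainAt_eq]
  obtain t | _ := z
  swap
  · exact hz.elim
  have hxt : x.1 ⊆ t.toFinset := hz
  have ht : t.toFinset.Nonempty := (Finset.nonempty_iff_ne_empty.2 x.ne_empty).mono hxt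
  refine Eq.trans ?_ (ε.sum_homotopy (coinducedCochainAt a (cell t)) ht.choose x.1 ?_)
  · refine Finset.sum_congr rfl fun d hd => ?_
    congr 1
    have hle : cell t ≤ cell (BooleanLattice.of (x.1.erase d)) :=
      (Finset.erase_subset d x.1).trans hxt
    refine (coinducedCochainAt_eq b (x.erase ⟨d, hd⟩) hle).trans ?_
    exact dif_pos ht
  -- Adjoining the cone vertex to `x` stays inside `t`, so the required vanishing is the cocycle
  -- condition for `a` at the enlarged set.
  · intro hc
    have hle : cell t ≤ cell (BooleanLattice.of (insert ht.choose x.1)) :=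
      Finset.insert_subset ht.choose_spec hxt
    let y : Row A (n + 2) := ⟨insert ht.choose x.1, by rw [Finset.card_insert_of_notMem hc, x.2]⟩
    refine (coinducedEval_cubeD ε a y hle).symm.trans ?_
    rw [ha]
    exact map_zero _

/-- Injectivity splits the embedding into the coinduced presheaf. A cocycle is pushed there,
bounded, and the bounding cochain is pulled back by the retraction. -/
lemma exists_cubeD_eq_of_injective (J : (ModifiedLattice A)ᵒᵖ ⥤ AddCommGrpCat.{0}) [Injective J]
    {n : ℕ} (a : CubeCochain (onCells J) (n + 1)) (ha : cubeD _ ε (n + 1) a = 0) :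
    ∃ b, cubeD _ ε n b = a := by
  let r := Injective.factorThru (𝟙 J) (toCoinduced J)
  have hr : toCoinduced J ≫ r = 𝟙 J := Injective.comp_factorThru _ _
  let σ := (cellFunctor A).op
  obtain ⟨b, hb⟩ := exists_cubeD_eq_coinduced ε
    (cubeCochainMap (Functor.whiskerLeft σ (toCoinduced J)) (n + 1) a)
    (by rw [← cubeD_naturality, ha, map_zero])
  refine ⟨cubeCochainMap (Functor.whiskerLeft σ r) n b, ?_⟩
  rw [← cubeD_naturality, hb, ← cubeCochainMap_comp, ← Functor.whiskerLeft_comp, hr,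
    Functor.whiskerLeft_id', cubeCochainMap_id]

lemma cochainComplex_exactAt_of_injective (J : (ModifiedLattice A)ᵒᵖ ⥤ AddCommGrpCat.{0})
    [Injective J] (n : ℕ) : ((cochainComplex ε).obj J).ExactAt (n + 1) := by
  rw [HomologicalComplex.exactAt_iff' _ n (n + 1) (n + 2) (by simp) (by simp),
    ShortComplex.ab_exact_iff]
  intro a ha
  change ∃ b, (((cochainComplex ε).obj J).d n (n + 1)).hom b = a
  change (((cochainComplex ε).obj J).d (n + 1) (n + 2)).hom a = 0 at ha
  rw [cochainComplex_d] at ha ⊢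
  obtain ⟨b, hb⟩ := exists_cubeD_eq_of_injective ε J a ha
  cases n with
  | zero =>
    -- In degree `0` the added summand can be set to zero, because the cells alone already bound
    -- `a`.
    refine ⟨(b, 0), ?_⟩
    refine (cochainD_zero_apply J ε b 0).trans ?_
    rw [map_zero, map_zero, sub_zero, hb]
  | succ n => exact ⟨b, hb⟩

/-! ### Degree zero cocycles as compatible families. -/

/-- A member of row `1` has a single face, `∅`. The differential there is one sign times the
difference of the two restrictions, and the sign is invertible. -/
lemma cochainD_zero_eq_zero_iff (a : CubeCochain (onCells G) 0) (b : CubeCochain (onExtra G) 0) :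
    (cochainD G ε 0).hom (a, b) = 0 ↔ ∀ x : Row A 1,
      (G.map (homOfLE (cell_le_cell_empty (BooleanLattice.of x.1))).op).hom (a (Row.empty A)) =
        (G.map (homOfLE (cell_le_extra x.ne_empty)).op).hom (b (Row.empty A)) := by
  have key : ∀ (x : Row A 1) (c : x.1), (cochainD G ε 0).hom (a, b) x =
      ε.sign ∅ c.1 •
        ((G.map (homOfLE (cell_le_cell_empty (BooleanLattice.of x.1))).op).hom (a (Row.empty A)) -
          (G.map (homOfLE (cell_le_extra x.ne_empty)).op).hom (b (Row.empty A))) := by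
    intro x c
    have hc : ∀ d : x.1, d = c := fun d => Subtype.ext
      (Finset.card_le_one.1 x.2.le _ d.2 _ c.2)
    have h : ∅ ⊆ x.1 := Finset.empty_subset _
    have he : x.erase c = Row.empty A := Row.eq_empty _
    have hsum : ∀ {M : Type} [AddCommGroup M] (f : x.1 → M), ∑ d : x.1, f d = f c := fun f =>
      Fintype.sum_eq_single c fun d hd => (hd (hc d)).elim
    change cubeD (onCells G) ε 0 a x - extraHom G x.ne_empty (cubeD (onExtra G) ε 0 b x) = _
    rw [cubeD_apply, cubeD_apply, hsum, hsum, map_units_smul, ← smul_sub,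
      cubeHom_congr _ a he (x.erase_subset c) h, cubeHom_congr _ b he (x.erase_subset c) h, he]
    exact congrArg (fun t => ε.sign ∅ c.1 • (cubeHom (onCells G) h (a (Row.empty A)) - extraHom G x.ne_empty t))
      (cubeHom_onExtra G h (b (Row.empty A)))
  constructor
  · intro h x
    obtain ⟨c, hc⟩ := Finset.nonempty_iff_ne_empty.2 x.ne_empty
    have := (key x ⟨c, hc⟩).symm.trans (congrFun h x)
    exact sub_eq_zero.1 ((smul_eq_zero_iff_eq _).1 this)
  · intro h
    funext x
    obtain ⟨c, hc⟩ := Finset.nonempty_iff_ne_empty.2 x.ne_empty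
    rw [key x ⟨c, hc⟩, h x, sub_self, smul_zero]
    rfl

lemma limToCochain_comp : limToCochain G ≫ cochainD G ε 0 = 0 := by
  ext v
  refine (cochainD_zero_eq_zero_iff G ε _ _).2 fun x => ?_
  exact (map_lim_π G (cell_le_cell_empty (BooleanLattice.of x.1)) v).trans
    (map_lim_π G (cell_le_extra x.ne_empty) v).symm

/-- Agreement on singletons suffices: every nonempty set lies below a singleton, through which both
restrictions factor. -/
lemma limToCochain_exact (a : cochain G 0) (ha : (cochainD G ε 0).hom a = 0) :
    ∃ v, (limToCochain G).hom v = a := by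
  obtain ⟨a, b⟩ := a
  have hab := (cochainD_zero_eq_zero_iff G ε a b).1 ha
  have hcomp : ∀ {x y z : ModifiedLattice A} (h : x ≤ y) (k : y ≤ z) (c : G.obj (Opposite.op z)),
      (G.map (homOfLE h).op).hom ((G.map (homOfLE k).op).hom c) =
        (G.map (homOfLE (h.trans k)).op).hom c := fun h k c =>
    (ConcreteCategory.congr_hom (G.map_comp (homOfLE k).op (homOfLE h).op) c).symm
  let s : ∀ z, G.obj (Opposite.op z) := fun z =>
    match z with
    | cell x => (G.map (homOfLE (cell_le_cell_empty x)).op).hom (a (Row.empty A))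
    | extra => b (Row.empty A)
  obtain ⟨v, hv⟩ := exists_lim_of_compatible G s (by
    rintro (x | _) (y | _) h
    · exact hcomp h (cell_le_cell_empty y) _
    · obtain ⟨c, hc⟩ := Finset.nonempty_iff_ne_empty.2 (show x.toFinset ≠ ∅ from h)
      let y : Row A 1 := ⟨{c}, Finset.card_singleton c⟩
      have hxy : cell x ≤ cell (BooleanLattice.of y.1) := Finset.singleton_subset_iff.2 hc
      have := congrArg (G.map (homOfLE hxy).op).hom (hab y)
      exact (hcomp hxy (cell_le_extra y.ne_empty) (b (Row.empty A))).symm.trans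
        (this.symm.trans (hcomp hxy (cell_le_cell_empty (BooleanLattice.of y.1))
          (a (Row.empty A))))
    · exact h.elim
    · exact ConcreteCategory.congr_hom (G.map_id (Opposite.op extra)) _)
  refine ⟨v, Prod.ext (funext fun x => ?_) (funext fun x => ?_)⟩
  · obtain rfl := x.eq_empty
    exact (hv _).trans (ConcreteCategory.congr_hom (G.map_id (Opposite.op (cell _))) _)
  · obtain rfl := x.eq_empty
    exact hv extra

/-- The zeroth cohomology is the inverse limit. -/
noncomputable def limIsoHomologyZero : (lim : ((ModifiedLattice A)ᵒᵖ ⥤ AddCommGrpCat.{0}) ⥤ _) ≅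
    cochainComplex ε ⋙ HomologicalComplex.homologyFunctor _ _ 0 :=
  isoHomologyZeroOfExact _ _ limToCochain limToCochain_naturality
    (fun G => by rw [cochainComplex_d]; exact limToCochain_comp G ε)
    (fun G => (AddCommGrpCat.mono_iff_injective _).2 (limToCochain_injective G))
    (fun G => by
      rw [ShortComplex.ab_exact_iff]
      intro a ha
      refine limToCochain_exact G ε a ?_
      rw [← cochainComplex_d]
      exact ha)

/-- The higher inverse limits over the modified Boolean lattice are the cohomology groups of the
cochain complex. -/
theorem nonempty_higherLimit_iso (i : ℕ) :
    Nonempty (higherLimit G i ≅ ((cochainComplex ε).obj G).homology i) :=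
  nonempty_rightDerived_iso_homology (cochainComplex ε) lim
    (fun _ hS => cochainComplex_shortExact ε hS)
    (fun J _ n => cochainComplex_exactAt_of_injective ε J n) (limIsoHomologyZero ε) G i

/-! ### Extension by zero and comparison with the cube complex. -/

/-- The cochains of a presheaf that is extended by zero. -/
def cochainExtendIso (F : (BooleanLattice A)ᵒᵖ ⥤ AddCommGrpCat.{0}) (n : ℕ) :
    cochain (extend F) n ≅ AddCommGrpCat.of (CubeCochain F n) :=
  match n with
  | 0 => AddEquiv.toAddCommGrpIso
    (X := AddCommGrpCat.of (CubeCochain (onCells (extend F)) 0 × CubeCochain (onExtra (extend F)) 0))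
    (Y := AddCommGrpCat.of (CubeCochain F 0))
    { toFun := fun a => a.1
      invFun := fun a => (a, 0)
      left_inv := fun _ => rfl
      right_inv := fun _ => rfl
      map_add' := fun _ _ => rfl }
  | n + 1 => Iso.refl (AddCommGrpCat.of (CubeCochain F (n + 1)))

lemma cochainExtendIso_comm (F : (BooleanLattice A)ᵒᵖ ⥤ AddCommGrpCat.{0}) (n : ℕ) :
    (cochainExtendIso F n).hom ≫ AddCommGrpCat.ofHom (cubeD F ε n) =
      cochainD (extend F) ε n ≫ (cochainExtendIso F (n + 1)).hom := by
  refine AddCommGrpCat.hom_ext (AddMonoidHom.ext fun a => ?_)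
  cases n with
  | zero =>
    obtain ⟨a, b⟩ := a
    -- The value at `extra` is the one-point group, so the second component is definitionally zero.
    obtain rfl : b = 0 := rfl
    refine Eq.trans ?_ (cochainD_zero_apply (extend F) ε a 0).symm
    rw [map_zero, map_zero, sub_zero]
    rfl
  | succ n => rfl

lemma _root_.cubeComplex_d (F : (BooleanLattice A)ᵒᵖ ⥤ AddCommGrpCat.{0}) (n : ℕ) :
    (cubeComplex F ε).d n (n + 1) = AddCommGrpCat.ofHom (cubeD F ε n) :=
  CochainComplex.of_d (fun n => AddCommGrpCat.of (CubeCochain F n))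
    (fun n => AddCommGrpCat.ofHom (cubeD F ε n)) n

/-- For a presheaf that is extended by zero, the cochain complex is the cochain complex of the
cube. -/
noncomputable def cochainComplexExtendIso (F : (BooleanLattice A)ᵒᵖ ⥤ AddCommGrpCat.{0}) :
    (cochainComplex ε).obj (extend F) ≅ cubeComplex F ε :=
  HomologicalComplex.Hom.isoOfComponents (cochainExtendIso F) (by
    rintro n _ rfl
    refine Eq.trans ?_ ((cochainExtendIso_comm ε F n).trans ?_)
    · exact congrArg _ (cubeComplex_d ε F n)
    · exact congrArg (· ≫ _) (cochainComplex_d _ ε n).symm)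

end ModifiedLattice

theorem theorem1p1 (D : LinkDiagram) (ε : CubeSigns D.Crossing) (i : ℕ) :
    Nonempty (D.unnormalisedKh ε i ≅
      higherLimit (ModifiedLattice.extend D.khovanovPresheaf) i) := by
  obtain ⟨e⟩ := ModifiedLattice.nonempty_higherLimit_iso
    (ModifiedLattice.extend D.khovanovPresheaf) ε i
  exact ⟨(e ≪≫ (HomologicalComplex.homologyFunctor _ _ i).mapIso
    (ModifiedLattice.cochainComplexExtendIso ε D.khovanovPresheaf)).symm⟩
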